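/- **Setting.** Let $U$, $L$, $V$ be pairwise disjoint countably infinite sets (identifiers, literals, variables), each with a fixed enumeration, which also gives its order and the binary representation of its elements. A *data triple* is an element $t$ of $U\times U\times(U\cup L)$; $\mathrm{ids}(t)$ is the set of identifiers in $t$. A *Web of Linked Data* is $W=(D,\mathrm{data},\mathrm{adoc})$ where $D$ is a finite or countably infinite set of documents, $\mathrm{data}$ assigns to each document a finite set of data triples, and $\mathrm{adoc}:U\rightharpoonup D$ is a partial surjective mapping. **Queries.** A *basic query pattern* (BQP) is a finite set $B\subset (V\cup U)\times(V\cup U)\times(V\cup U\cup L)$. A *valuation* is a partial mapping $\mu:V\rightharpoonup U\cup L$ with finite domain; $\mu[B]$ is $B$ with each variable $v\in\mathrm{dom}(\mu)$ replaced by $\mu(v)$. A *reachability criterion* is a total, Turing computable function $c$ from triples (data triple, identifier, BQP) to truth values. Given $B$, a finite set $S\subset U$ and a criterion $c$, the *reachable* documents of $W$ form the smallest set that contains $\mathrm{adoc}(u)$ for all $u\in S\cap\mathrm{dom}(\mathrm{adoc})$ and that contains $\mathrm{adoc}(u)$ whenever $u\in\mathrm{ids}(t)\cap\mathrm{dom}(\mathrm{adoc})$,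 $t\in\mathrm{data}(d)$ for a reachable $d$, and $c(t,u,B)=\mathrm{true}$; the subweb of $W$ that they induce is the reachable part of $W$. A *Linked Data query* is a mapping from Webs of Linked Data to sets of valuations. The *conjunctive Linked Data (CLD) query* given by $(B,S,c)$ maps $W$ to the set of all valuations $\mu$ such that $\mathrm{dom}(\mu)$ is the set of variables of $B$ and every element of $\mu[B]$ is a data triple of some document of the reachable part of $W$. **Encodings.** Over a fixed finite alphabet, identifiers, literals and variables are represented by pairwise distinct words: a marker for the kind, followed by a binary numeral. A data triple is encoded as $\langle\mathrm{enc}(s),\mathrm{enc}(p),\mathrm{enc}(o)\rangle$, and a document $d$ as the list $\langle\!\langle\dots\rangle\!\rangle$ of the encodings of the triples in $\mathrm{data}(d)$ in increasing order. $W$ is encoded as the finite or infinite word $\sharp\,\mathrm{enc}(u_1)\,\mathrm{enc}(\mathrm{adoc}(u_1))\,\sharp\,\mathrm{enc}(u_2)\,\mathrm{enc}(\mathrm{adoc}(u_2))\,\sharp\cdots$, where $u_1,u_2,\dots$ are the elements of $\mathrm{dom}(\mathrm{adoc})$ in increasing order. A valuation is encoded as the list $\langle\!\langle \mathrm{enc}(v_1)\to\mathrm{enc}(\mu(v_1)),\dots\rangle\!\rangle$,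 in the order of the variables. A possible encoding of a set $\Omega$ of valuations is a (finite or infinite) concatenation of the encodings of the elements of $\Omega$, each used exactly once, in any order. **Machines.** An *LD machine* is a deterministic Turing machine with finitely many states, one of which is called *expand*, and five tapes: a read-only input tape; a read-only, right-infinite Web tape; a two-way infinite work tape; a right-infinite link traversal tape; and a right-infinite, append-only output tape. Initially the work, link traversal and output tapes are empty and $\mathrm{enc}(W)$ is on the Web tape. The Web tape is used only in the expand state, where the machine does the following before it continues as an ordinary Turing machine: if the word on the link traversal tape ends with $\mathrm{enc}(u)$ for some $u\in U$ and the Web tape contains $\sharp\,\mathrm{enc}(u)\,\mathrm{enc}(\mathrm{adoc}(u))\,\sharp$, then it appends $\mathrm{enc}(\mathrm{adoc}(u))\,\sharp$ to the word on the link traversal tape; otherwise it appends $\sharp$. A Linked Data query $q$ is *finitely computable* if there is an LD machine that, for every Web of Linked Data $W$ on its Web tape (and an empty input tape), halts after finitely many steps with a possible encoding of $q(W)$ on its output tape. It is *eventually computable* if there is an LD machine such that, for every Web of Linked Data $W$ on its Web tape (and an empty input tape), (1) at each step of the computation the word on the output tape is a prefix of a possible encoding of $q(W)$, and (2) for each $\mu\in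 q(W)$, the word $\mathrm{enc}(\mu)$ is part of the word on the output tape after finitely many steps. **Theorem.** Every CLD query is finitely computable or eventually computable. -/

import Mathlib

/-!
# Linked Data queries and LD machines

The countably infinite sets of identifiers `U`, of literals `L` and of query variables `V` are
types with a fixed enumeration (`Denumerable`); disjoint unions are sum types. The enumeration
gives the order of the elements and, through binary numerals, their representation on tapes.
-/

namespace LinkedData

/-! ## Data model -/

/-- A data triple: an element of `U × U × (U ∪ L)`. -/
abbrev Triple (U L : Type) : Type := U × U × (U ⊕ L)

/-- `OccursIn u t`: the identifier `u` belongs to `ids(t)`. -/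
def OccursIn {U L : Type} (u : U) (t : Triple U L) : Prop :=
  u = t.1 ∨ u = t.2.1 ∨ t.2.2 = Sum.inl u

/-- A Web of Linked Data `(D, data, adoc)`. The partial mapping `adoc` is surjective, so `D` is
automatically finite or countably infinite. -/
structure Web (U L : Type) where
  D : Type
  data : D → Finset (Triple U L)
  adoc : U → Option D
  adoc_surjective : ∀ d : D, ∃ u : U, adoc u = some d

/-- All data triples of a Web of Linked Data. -/
def Web.allData {U L : Type} (W : Web U L) : Set (Triple U L) :=
  {t | ∃ d : W.D, t ∈ W.data d}

open Classical in
/-- The subweb of `W` induced by the set `D'` of documents. -/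
noncomputable def Web.induced {U L : Type} (W : Web U L) (D' : Set W.D) : Web U L where
  D := D'
  data := fun d => W.data d.1
  adoc := fun u => (W.adoc u).bind fun d => if h : d ∈ D' then some ⟨d, h⟩ else none
  adoc_surjective := by
    rintro ⟨d, hd⟩
    obtain ⟨u, hu⟩ := W.adoc_surjective d
    exact ⟨u, by simp [hu, hd]⟩

/-! ## Query model -/

/-- A triple pattern: an element of `(V ∪ U) × (V ∪ U) × (V ∪ U ∪ L)`. -/
abbrev Pattern (V U L : Type) : Type := (V ⊕ U) × (V ⊕ U) × (V ⊕ (U ⊕ L))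

/-- A basic query pattern: a finite set of triple patterns. -/
abbrev BQP (V U L : Type) : Type := Finset (Pattern V U L)

/-- `vars(B)`. -/
def BQP.vars {V U L : Type} (B : BQP V U L) : Set V :=
  {v | ∃ tp ∈ B, tp.1 = Sum.inl v ∨ tp.2.1 = Sum.inl v ∨ tp.2.2 = Sum.inl v}

/-- A valuation: a partial mapping from `V` to `U ∪ L` with finite domain. -/
structure Valuation (V U L : Type) where
  toFun : V → Option (U ⊕ L)
  finite_dom : {v | (toFun v).isSome = true}.Finite

/-- The domain of a valuation. -/
def Valuation.dom {V U L : Type} (μ : Valuation V U L) : Set V :=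
  {v | (μ.toFun v).isSome = true}

/-- Replace a variable in the domain of `μ` by its value; everything else is left unchanged. -/
def Valuation.applyTerm {V U L : Type} (μ : Valuation V U L) : V ⊕ (U ⊕ L) → V ⊕ (U ⊕ L)
  | Sum.inl v => (μ.toFun v).elim (Sum.inl v) Sum.inr
  | Sum.inr x => Sum.inr x

/-- `μ[tp]`: the triple of terms obtained from `tp` by replacing variables according to `μ`. -/
def Valuation.applyPattern {V U L : Type} (μ : Valuation V U L) (tp : Pattern V U L) :
    (V ⊕ (U ⊕ L)) × (V ⊕ (U ⊕ L)) × (V ⊕ (U ⊕ L)) :=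
  (μ.applyTerm (Sum.map id Sum.inl tp.1), μ.applyTerm (Sum.map id Sum.inl tp.2.1),
    μ.applyTerm tp.2.2)

/-- A data triple, seen as a triple of terms. -/
def Triple.toTerms {U L : Type} (V : Type) (t : Triple U L) :
    (V ⊕ (U ⊕ L)) × (V ⊕ (U ⊕ L)) × (V ⊕ (U ⊕ L)) :=
  (Sum.inr (Sum.inl t.1), Sum.inr (Sum.inl t.2.1), Sum.inr t.2.2)

/-- `μ` is a solution for `B` over the set `T` of data triples:
`dom(μ) = vars(B)` and `μ[B] ⊆ T`. -/
def IsSolution {V U L : Type} (B : BQP V U L) (T : Set (Triple U L))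
    (μ : Valuation V U L) : Prop :=
  μ.dom = BQP.vars B ∧ ∀ tp ∈ B, ∃ t ∈ T, μ.applyPattern tp = Triple.toTerms V t

/-- A Linked Data query: a total mapping from Webs of Linked Data to sets of valuations. -/
abbrev Query (V U L : Type) : Type 1 := Web U L → Set (Valuation V U L)

/-- A reachability criterion: a Turing computable total function that assigns a truth value to
each data triple, identifier and basic query pattern. -/
structure ReachabilityCriterion (V U L : Type) [Denumerable V] [Denumerable U]
    [Denumerable L] where
  toFun : Triple U L → U → BQP V U L → Bool
  computable : Computable fun x : Triple U L × U × BQP V U L => toFun x.1 x.2.1 x.2.2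

/-- `Reachable W S P d`: document `d` is reachable from the seed identifiers `S` in `W`, where a
link given by an identifier `u` in a data triple `t` may be followed if `P t u = true`. -/
inductive Reachable {U L : Type} (W : Web U L) (S : Finset U) (P : Triple U L → U → Bool) :
    W.D → Prop
  | seed (u : U) (d : W.D) : u ∈ S → W.adoc u = some d → Reachable W S P d
  | link (d' d : W.D) (t : Triple U L) (u : U) : Reachable W S P d' → t ∈ W.data d' →
      OccursIn u t → W.adoc u = some d → P t u = true → Reachable W S P d

/-- A conjunctive Linked Data query, given by a basic query pattern, a finite set of seed
identifiers and a reachability criterion. -/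
structure CLDQuery (V U L : Type) [Denumerable V] [Denumerable U] [Denumerable L] where
  bqp : BQP V U L
  seeds : Finset U
  criterion : ReachabilityCriterion V U L

/-- The `(S, c, B)`-reachable part of `W`: the subweb induced by the reachable documents. -/
noncomputable def CLDQuery.reachablePart {V U L : Type} [Denumerable V] [Denumerable U]
    [Denumerable L] (q : CLDQuery V U L) (W : Web U L) : Web U L :=
  W.induced {d | Reachable W q.seeds (fun t u => q.criterion.toFun t u q.bqp) d}

/-- The mapping from Webs to query results that is defined by a conjunctive Linked Data query. -/
def CLDQuery.eval {V U L : Type} [Denumerable V] [Denumerable U] [Denumerable L]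
    (q : CLDQuery V U L) : Query V U L :=
  fun W => {μ | IsSolution q.bqp (q.reachablePart W).allData μ}

/-! ## Encodings -/

/-- The symbols used in encodings. The markers `ident`, `lit` and `var` begin the representation
of an identifier, of a literal and of a variable. -/
inductive Sym : Type
  | bit (b : Bool)
  | ident
  | lit
  | var
  | sharp
  | langle
  | rangle
  | llangle
  | rrangle
  | comma
  | arrow

/-- The binary representation (least significant bit first) of the index of an element. -/
def encBinary {α : Type} [Encodable α] (a : α) : List Sym :=
  (Nat.bits (Encodable.encode a)).map Sym.bit

def encId {U : Type} [Encodable U] (u : U) : List Sym := Sym.ident :: encBinary u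

def encLit {L : Type} [Encodable L] (l : L) : List Sym := Sym.lit :: encBinary l

def encVar {V : Type} [Encodable V] (v : V) : List Sym := Sym.var :: encBinary v

/-- The encoding of an element of `U ∪ L`. -/
def encConst {U L : Type} [Encodable U] [Encodable L] : U ⊕ L → List Sym
  | Sum.inl u => encId u
  | Sum.inr l => encLit l

/-- `⟨ enc(s) , enc(p) , enc(o) ⟩` -/
def encTriple {U L : Type} [Encodable U] [Encodable L] (t : Triple U L) : List Sym :=
  Sym.langle :: (encId t.1 ++ [Sym.comma] ++ encId t.2.1 ++ [Sym.comma] ++ encConst t.2.2 ++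
    [Sym.rangle])

/-- `⟪ w₁ , … , wₙ ⟫` -/
def encList (ws : List (List Sym)) : List Sym :=
  Sym.llangle :: ([Sym.comma].intercalate ws ++ [Sym.rrangle])

/-- Data triples are ordered lexicographically, via the indices of their components. -/
def tripleKey (U L : Type) [Encodable U] [Encodable L] : Triple U L ↪ ℕ ×ₗ (ℕ ×ₗ ℕ) where
  toFun := fun t =>
    toLex (Encodable.encode t.1, toLex (Encodable.encode t.2.1, Encodable.encode t.2.2))
  inj' := by
    rintro ⟨s, p, o⟩ ⟨s', p', o'⟩ h
    simpa using h

instance {U L : Type} [Encodable U] [Encodable L] :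
    Std.Antisymm (tripleKey U L ⁻¹'o (· ≤ ·)) :=
  (RelEmbedding.preimage _ _).antisymm

instance {U L : Type} [Encodable U] [Encodable L] :
    Std.Total (tripleKey U L ⁻¹'o (· ≤ ·)) :=
  (RelEmbedding.preimage _ _).total

/-- The encoding of a finite set of data triples, listed in increasing order; also the encoding
of a document with these data triples. -/
def encTriples {U L : Type} [Encodable U] [Encodable L] (T : Finset (Triple U L)) : List Sym :=
  encList ((T.sort (tripleKey U L ⁻¹'o (· ≤ ·))).map encTriple)

/-- The initial part of the encoding `♯ enc(u₁) enc(adoc(u₁)) ♯ enc(u₂) enc(adoc(u₂)) ♯ …` of `W`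
that comes from the first `n` identifiers, where `u₁, u₂, …` are the elements of `dom(adoc)` in
increasing order. -/
def webPrefix {U L : Type} [Denumerable U] [Encodable L] (W : Web U L) (n : ℕ) : List Sym :=
  Sym.sharp :: (List.range n).flatMap fun i =>
    match W.adoc (Denumerable.ofNat U i) with
    | none => []
    | some d => encId (Denumerable.ofNat U i) ++ encTriples (W.data d) ++ [Sym.sharp]

open Classical in
/-- The right-infinite tape with the (finite or infinite) word `enc(W)`; blank cells are `none`. -/
noncomputable def webTape {U L : Type} [Denumerable U] [Encodable L] (W : Web U L) :
    ℕ → Option Sym :=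
  fun k => if h : ∃ n, k < (webPrefix W n).length then (webPrefix W (Nat.find h))[k]? else none

/-- `⟪ enc(v₁) → enc(μ(v₁)) , … , enc(vₙ) → enc(μ(vₙ)) ⟫`, where `v₁, …, vₙ` are the elements of
`dom(μ)` in increasing order. -/
noncomputable def encValuation {V U L : Type} [Encodable V] [Encodable U] [Encodable L]
    (μ : Valuation V U L) : List Sym :=
  encList ((μ.finite_dom.toFinset.sort (Encodable.encode' V ⁻¹'o (· ≤ ·))).map fun v =>
    encVar v ++ [Sym.arrow] ++ (μ.toFun v).elim [] encConst)

/-- The word `w` is a possible encoding of the set `Ω` of valuations: a concatenation of the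
encodings of the elements of `Ω`, each used once, in any order. -/
def IsEncoding {V U L : Type} [Encodable V] [Encodable U] [Encodable L]
    (Ω : Set (Valuation V U L)) (w : List Sym) : Prop :=
  ∃ l : List (Valuation V U L), l.Nodup ∧ (∀ μ, μ ∈ l ↔ μ ∈ Ω) ∧ w = l.flatMap encValuation

/-- The word `p` is a prefix of a possible encoding of `Ω`. The second case is about infinite `Ω`,
whose encodings are the infinite words `enc(e 0) enc(e 1) …` for the enumerations `e` of `Ω`
without repetition. -/
def IsPrefixOfEncoding {V U L : Type} [Encodable V] [Encodable U] [Encodable L]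
    (Ω : Set (Valuation V U L)) (p : List Sym) : Prop :=
  (∃ w, IsEncoding Ω w ∧ p <+: w) ∨
  (∃ e : ℕ → Valuation V U L, Function.Injective e ∧ Set.range e = Ω ∧
    ∃ n, p <+: ((List.range n).map e).flatMap encValuation)

/-! ## LD machines -/

/-- A head movement; on a right-infinite tape a head in the leftmost cell does not move left. -/
inductive Move : Type
  | left
  | stay
  | right

def Move.onNat : Move → ℕ → ℕ
  | left, i => i - 1
  | stay, i => i
  | right, i => i + 1

def Move.onInt : Move → ℤ → ℤ
  | left, i => i - 1
  | stay, i => i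
  | right, i => i + 1

def Move.onTape {Γ : Type} [Inhabited Γ] : Move → Turing.Tape Γ → Turing.Tape Γ
  | left, T => T.move Turing.Dir.left
  | stay, T => T
  | right, T => T.move Turing.Dir.right

/-- What an ordinary step does: enter a state, move the head of the input tape, write on the work
tape and on the link traversal tape and move their heads, and append at most one symbol to the
word on the output tape. -/
structure Action (State Γ : Type) where
  next : State
  inputMove : Move
  workWrite : Γ
  workMove : Move
  linkWrite : Option Sym
  linkMove : Move
  output : Option Sym

/-- An LD machine. The work tape has a finite alphabet `Γ` (with blank symbol `default`) of the
machine's choice; cells of the input tape and of the link traversal tape hold a symbol or are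
blank (`none`). An ordinary step depends on the state and on the symbols under the heads of the
input, work and link traversal tapes; the machine halts where `δ` is undefined. -/
structure LDMachine where
  State : Type
  Γ : Type
  finite_state : Finite State
  finite_Γ : Finite Γ
  inhabited_Γ : Inhabited Γ
  start : State
  expand : State
  δ : State → Option Sym → Γ → Option Sym → Option (Action State Γ)

instance (M : LDMachine) : Inhabited M.Γ := M.inhabited_Γ

/-- A configuration. The input tape and the Web tape are never changed and are not part of it. -/
structure LDMachine.Config (M : LDMachine) where
  state : M.State
  inputPos : ℤ
  work : Turing.Tape M.Γ
  link : ℕ → Option Sym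
  linkPos : ℕ
  output : List Sym

/-- A word on an otherwise blank two-way infinite tape. -/
def inputTape (w : List Sym) : ℤ → Option Sym :=
  fun i => if 0 ≤ i then w[i.toNat]? else none

/-- The length of the word on a right-infinite tape, which ends with the last nonblank cell. -/
noncomputable def wordLength (T : ℕ → Option Sym) : ℕ := sInf {n | ∀ m, n ≤ m → T m = none}

/-- The word on a right-infinite tape (with possible blanks between its symbols). -/
noncomputable def tapeWord (T : ℕ → Option Sym) : List (Option Sym) :=
  (List.range (wordLength T)).map T

/-- Append `w` to the right end of the word on a right-infinite tape. -/
noncomputable def appendWord (T : ℕ → Option Sym) (w : List Sym) : ℕ → Option Sym :=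
  fun i => if i < wordLength T then T i else w[i - wordLength T]?

/-- The right-infinite tape `T` contains the word `w`. -/
def TapeContains (T : ℕ → Option Sym) (w : List Sym) : Prop :=
  ∃ k, ∀ i, i < w.length → T (k + i) = w[i]?

open Classical in
/-- What the expand procedure appends to the word on the link traversal tape `link`: the word
`enc(d) ♯` if `link` ends with some `enc(u)` and the Web tape `web` contains `♯ enc(u) enc(d) ♯`
for a document (a finite set of data triples) `d`, and `♯` otherwise. -/
noncomputable def expansion (U L : Type) [Encodable U] [Encodable L]
    (web link : ℕ → Option Sym) : List Sym :=
  if h : ∃ d : Finset (Triple U L), ∃ u : U, (encId u).map some <:+ tapeWord link ∧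
      TapeContains web ([Sym.sharp] ++ encId u ++ encTriples d ++ [Sym.sharp])
  then encTriples h.choose ++ [Sym.sharp] else [Sym.sharp]

open Classical in
/-- The effect of the state on the tapes: in the expand state, the expand procedure. -/
noncomputable def LDMachine.prepare (U L : Type) [Encodable U] [Encodable L] (M : LDMachine)
    (web : ℕ → Option Sym) (C : M.Config) : M.Config :=
  if C.state = M.expand then { C with link := appendWord C.link (expansion U L web C.link) }
  else C

/-- One step of computation, or `none` if the machine halts. In the expand state the expand
procedure is performed before the ordinary step. -/
noncomputable def LDMachine.step (U L : Type) [Encodable U] [Encodable L] (M : LDMachine)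
    (input : ℤ → Option Sym) (web : ℕ → Option Sym) (C : M.Config) : Option M.Config :=
  let C' := M.prepare U L web C
  (M.δ C'.state (input C'.inputPos) C'.work.head (C'.link C'.linkPos)).map fun a =>
    { state := a.next
      inputPos := a.inputMove.onInt C'.inputPos
      work := a.workMove.onTape (C'.work.write a.workWrite)
      link := Function.update C'.link C'.linkPos a.linkWrite
      linkPos := a.linkMove.onNat C'.linkPos
      output := C'.output ++ a.output.toList }

/-- The initial configuration: work, link traversal and output tapes are empty. -/
def LDMachine.init (M : LDMachine) : M.Config where
  state := M.start
  inputPos := 0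
  work := default
  link := fun _ => none
  linkPos := 0
  output := []

/-- The configuration after `n` steps (or at the halt, if that comes earlier) of the computation
on the Web `W` with the word `x` on the ordinary input tape. -/
noncomputable def LDMachine.run {U L : Type} [Denumerable U] [Denumerable L] (M : LDMachine)
    (x : List Sym) (W : Web U L) : ℕ → M.Config
  | 0 => M.init
  | n + 1 => (M.step U L (inputTape x) (webTape W) (M.run x W n)).getD (M.run x W n)

/-- The machine has halted after at most `n` steps. -/
def LDMachine.HaltedAt {U L : Type} [Denumerable U] [Denumerable L] (M : LDMachine)
    (x : List Sym) (W : Web U L) (n : ℕ) : Prop :=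
  M.step U L (inputTape x) (webTape W) (M.run x W n) = none

/-! ## Computability of Linked Data queries -/

/-- A query is finitely computable if some LD machine, on every Web, halts after finitely many
steps with a possible encoding of the query result on its output tape. -/
def FinitelyComputable {V U L : Type} [Denumerable V] [Denumerable U] [Denumerable L]
    (q : Query V U L) : Prop :=
  ∃ M : LDMachine, ∀ W : Web U L, ∃ n,
    M.HaltedAt [] W n ∧ IsEncoding (q W) (M.run [] W n).output

/-- A query is eventually computable if for some LD machine and every Web, the output at each step
is a prefix of a possible encoding of the query result, and the encoding of each element of the
query result is part of the output after finitely many steps. -/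
def EventuallyComputable {V U L : Type} [Denumerable V] [Denumerable U] [Denumerable L]
    (q : Query V U L) : Prop :=
  ∃ M : LDMachine, ∀ W : Web U L,
    (∀ n, IsPrefixOfEncoding (q W) (M.run [] W n).output) ∧
    (∀ μ ∈ q W, ∃ n, encValuation μ <:+: (M.run [] W n).output)

end LinkedData

namespace LinkedData

open Turing StateTransition Turing.PartrecToTM2

/-! ## Finite types of symbols and commands -/

/-! Every CLD query is eventually computable, so the second alternative always holds. Reachability
need not guide the search: the machine looks up all identifiers in the order of `U`, whether or not
they are linked, and decides afterwards which retrieved documents count.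

After `k` lookups it follows links for `k` rounds inside the retrieved documents and determines the
solutions with code below `k` over the triples reached so far. It outputs those that did not meet
this test one lookup earlier. Everything found is correct, because links followed among retrieved
documents are links of `W`. Everything is found, because a reachable document has a finite chain of
links and a solution uses finitely many triples (`exists_isKnownSolution`). The test is monotone in
`k`, so each solution is output exactly once (`nodup_flatMap_newSolutions`). A concatenation of
encodings of distinct solutions always extends to an encoding of the countable set of all solutions
(`isPrefixOfEncoding_flatMap`), and the output at an arbitrary step is a prefix of such a
concatenation.

The search is first described as a process: a computable map from a state and the scanned symbol of
the link traversal tape to a new state and one elementary command. `exists_machine_of_computable`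
turns any such process into an LD machine. The transition map is compiled through `ToPartrec.Code`
to a stack machine and then to a one-tape machine on the work tape. A result (new state, command) is
the number `2 ^ command * (2 * state + 1)`. Popping its low zeros into a bounded counter reveals the
command, and after the digit one exactly the new state is left on the stack, as input of the next
computation.

The link to the Web is `expansion_webTape`: the separators `♯` and injectivity of the encodings
force the answer to `u` to be the document of `u`. -/

def Sym.equivFin : Sym ≃ Fin 12 where
  toFun
    | .bit false => 0
    | .bit true => 1
    | .ident => 2
    | .lit => 3
    | .var => 4
    | .sharp => 5
    | .langle => 6
    | .rangle => 7
    | .llangle => 8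
    | .rrangle => 9
    | .comma => 10
    | .arrow => 11
  invFun := ![.bit false, .bit true, .ident, .lit, .var, .sharp, .langle, .rangle, .llangle,
    .rrangle, .comma, .arrow]
  left_inv x := by rcases x with (_ | _) | _ <;> rfl
  right_inv i := by fin_cases i <;> rfl

instance : DecidableEq Sym := Sym.equivFin.decidableEq
instance : Finite Sym := Finite.of_equiv _ Sym.equivFin.symm
instance : Fintype Sym := Fintype.ofEquiv _ Sym.equivFin.symm
instance : Primcodable Sym := Primcodable.ofEquiv _ Sym.equivFin

/-- The elementary actions of a machine on its link traversal and output tapes. -/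
inductive Cmd : Type
  | nop
  | write (x : Sym)
  | output (x : Sym)
  | expand
  | advance

def Cmd.equivOption : Cmd ≃ Option (Sym ⊕ Sym ⊕ Bool) where
  toFun
    | .nop => none
    | .write x => some (.inl x)
    | .output x => some (.inr (.inl x))
    | .expand => some (.inr (.inr false))
    | .advance => some (.inr (.inr true))
  invFun
    | none => .nop
    | some (.inl x) => .write x
    | some (.inr (.inl x)) => .output x
    | some (.inr (.inr false)) => .expand
    | some (.inr (.inr true)) => .advance
  left_inv x := by cases x <;> rfl
  right_inv x := by rcases x with _ | _ | _ | _ | _ <;> rfl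

instance : Finite Cmd := Finite.of_equiv _ Cmd.equivOption.symm
instance : Primcodable Cmd := Primcodable.ofEquiv _ Cmd.equivOption

/-! ## A stack machine that stops with the digits of its result on a stack -/

instance : Fintype K' := ⟨{.main, .rev, .aux, .stack}, fun k => by cases k <;> simp⟩

/-- Configurations of the stack machines. -/
abbrev StackCfg : Type :=
  TM2.Cfg (fun _ : K' => PartrecToTM2.Γ') PartrecToTM2.Λ' (Option PartrecToTM2.Γ')

/-- The machine of `PartrecToTM2`, except that instead of halting with a result on the main stack
it pops a symbol from this stack into its local variable. -/
def popTr (q : PartrecToTM2.Λ') :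
    TM2.Stmt (fun _ : K' => PartrecToTM2.Γ') PartrecToTM2.Λ' (Option PartrecToTM2.Γ') :=
  if q = Λ'.ret Cont'.halt then TM2.Stmt.pop K'.main (fun _ v => v) TM2.Stmt.halt else tr q

theorem popTr_ret_halt :
    popTr (Λ'.ret Cont'.halt) = TM2.Stmt.pop K'.main (fun _ v => v) TM2.Stmt.halt := if_pos rfl

theorem popTr_of_ne {q : PartrecToTM2.Λ'} (h : q ≠ Λ'.ret Cont'.halt) : popTr q = tr q := if_neg h

/-- Every other label ends its statement with a jump to some label. Hence `popTr` and `tr` differ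
only in the step that stops. -/
theorem eq_ret_halt_of_stepAux_tr {q : PartrecToTM2.Λ'} {v : Option PartrecToTM2.Γ'}
    {S : K' → List PartrecToTM2.Γ'} (h : (TM2.stepAux (tr q) v S).l = none) :
    q = Λ'.ret Cont'.halt := by
  cases q with
  | ret k => 
    cases k with
    | halt => rfl
    | _ => simp [tr] at h
  | move p k₁ k₂ q =>
    simp only [tr, pop', push', TM2.stepAux] at h
    cases hh : (S k₁).head?.elim true p <;> simp [hh] at h
  | clear p k q =>
    simp only [tr, pop', TM2.stepAux] at h
    cases hh : (S k).head?.elim true p <;> simp [hh] at h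
  | copy q =>
    simp only [tr, pop', push', TM2.stepAux] at h
    cases hh : (S K'.rev).head?.isSome <;> simp [hh] at h
  | push k f q => simp only [tr, TM2.stepAux] at h; cases hh : (f v).isSome <;> simp [hh] at h
  | read f => simp [tr] at h
  | succ q =>
    simp only [tr, pop', TM2.stepAux, Bool.cond_decide] at h
    split_ifs at h
  | pred q₁ q₂ =>
    simp only [tr, pop', peek', TM2.stepAux, Bool.cond_eq_ite] at h
    split_ifs at h

theorem popTr_reaches {a b : StackCfg} (h : Reaches (TM2.step tr) a b) (hb : b.l = none)
    (ha : a.l ≠ none) :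
    ∃ s, Reaches (TM2.step popTr) a ⟨some (Λ'.ret Cont'.halt), s, b.stk⟩ := by
  induction h using Relation.ReflTransGen.head_induction_on with
  | refl => exact absurd hb ha
  | @head a a' h₁ h₂ ih =>
    obtain ⟨l, v, S⟩ := a
    cases l with
    | none => exact absurd rfl ha
    | some q =>
      by_cases hq : q = Λ'.ret Cont'.halt
      · subst hq
        simp only [TM2.step, tr, TM2.stepAux, Option.mem_def, Option.some.injEq] at h₁
        subst h₁
        rcases Relation.ReflTransGen.cases_head h₂ with rfl | ⟨c, hc, -⟩
        · exact ⟨v, .refl⟩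
        · cases hc
      · have h₁' : a' = TM2.stepAux (tr q) v S := by simpa [TM2.step, eq_comm] using h₁
        have hl : a'.l ≠ none := fun h => hq (eq_ret_halt_of_stepAux_tr (h₁' ▸ h))
        obtain ⟨s, hs⟩ := ih hl
        refine ⟨s, .head ?_ hs⟩
        simp [TM2.step, popTr_of_ne hq, h₁']

/-- Numbers lie on the stack with the lowest digit on top, so popping a symbol splits off the
parity. In the even case zero is excluded, as it has no digits. -/
theorem trNat_two_mul_add_one (m : ℕ) : trNat (2 * m + 1) = Γ'.bit1 :: trNat m := by
  have : ((2 * m + 1 : ℕ) : Num) = Num.bit1 (m : Num) := by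
    rw [← Num.bit1_of_bit1, two_mul]; push_cast; rfl
  rw [trNat, this, trNat]
  cases (m : Num) <;> rfl

theorem trNat_two_mul {m : ℕ} (hm : m ≠ 0) : trNat (2 * m) = Γ'.bit0 :: trNat m := by
  have : ((2 * m : ℕ) : Num) = Num.bit0 (m : Num) := by
    rw [← Num.bit0_of_bit0, two_mul]; push_cast; rfl
  have h0 : (m : Num) ≠ 0 := by exact_mod_cast hm
  rw [trNat, this, trNat]
  cases h : (m : Num) 
  · exact absurd h h0
  · rfl

/-- The label that puts the word `l` on the main stack and continues at `q`. -/
def pushLabel (q : PartrecToTM2.Λ') : List PartrecToTM2.Γ' → PartrecToTM2.Λ' 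
  | [] => q
  | g :: l => pushLabel (Λ'.push K'.main (fun _ => some g) q) l

theorem pushLabel_reaches (q : PartrecToTM2.Λ') (l m : List PartrecToTM2.Γ') (v) :
    Reaches (TM2.step popTr) ⟨some (pushLabel q l), v, K'.elim m [] [] []⟩
      ⟨some q, v, K'.elim (l ++ m) [] [] []⟩ := by
  induction l generalizing q with
  | nil => exact .refl
  | cons g l ih =>
    refine (ih _).tail ?_
    simp [TM2.step, popTr]

/-- The label that puts the number `n` on the main stack and runs the code `c`. -/
def inputLabel (c : ToPartrec.Code) (n : ℕ) : PartrecToTM2.Λ' :=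
  pushLabel (trNormal c Cont'.halt) (trNat n ++ [Γ'.cons])

theorem inputLabel_reaches (c : ToPartrec.Code) (n : ℕ) (v : List ℕ) :
    Reaches (TM2.step popTr) ⟨some (inputLabel c n), none, K'.elim (trList v) [] [] []⟩
      (init c (n :: v)) := by
  simpa [init, inputLabel] using pushLabel_reaches (trNormal c Cont'.halt) (trNat n ++ [Γ'.cons])
    (trList v) none

theorem code_reaches {c : ToPartrec.Code} {v w : List ℕ} (h : c.eval v = pure w) :
    ∃ s, Reaches (TM2.step popTr) (init c v)
      ⟨some (Λ'.ret Cont'.halt), s, K'.elim (trList w) [] [] []⟩ := by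
  have := tr_eval c v
  rw [h] at this
  have hm : halt w ∈ eval (TM2.step tr) (init c v) := by
    rw [this]; exact Part.mem_some (halt w)
  exact popTr_reaches (mem_eval.1 hm).1 rfl (by simp [init])

/-! ### Finitely many labels -/

theorem pushLabel_supports {S : Finset PartrecToTM2.Λ'} {q : PartrecToTM2.Λ'} (h : q.Supports S)
    (l : List PartrecToTM2.Γ') : (pushLabel q l).Supports S := by
  induction l generalizing q with
  | nil => exact h
  | cons g l ih => exact ih (by exact h)

-- An LD machine has finitely many states while the labels form an infinite type. The words in `T`
-- are the inputs that will be pushed before a computation.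
open Classical in
theorem exists_popTr_supports (c : ToPartrec.Code) (T : Finset (List PartrecToTM2.Γ')) :
    ∃ S : Finset PartrecToTM2.Λ', TM2.Supports popTr S ∧ Λ'.ret Cont'.halt ∈ S ∧
      ∀ l ∈ T, pushLabel (trNormal c Cont'.halt) l ∈ S := by
  let S := {Λ'.ret Cont'.halt} ∪ (codeSupp c Cont'.halt ∪
    T.biUnion fun l => trStmts₁ (pushLabel (trNormal c Cont'.halt) l))
  have hS : codeSupp c Cont'.halt ⊆ S := fun x hx => by simp [S, hx]
  refine ⟨S, ⟨by simp [S, default], fun q hq => ?_⟩, by simp [S], fun l hl => ?_⟩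
  · by_cases h : q = Λ'.ret Cont'.halt
    · simp [h, popTr_ret_halt, TM2.SupportsStmt]
    · rw [popTr_of_ne h]
      simp only [S, Finset.mem_union, Finset.mem_singleton, h, false_or, Finset.mem_biUnion] at hq
      rcases hq with hq | ⟨l, hl, hq⟩
      · exact codeSupp_supports hS _ hq
      · refine trStmts₁_supports (pushLabel_supports (trNormal_supports hS) l) ?_ _ hq
        intro x hx
        simp only [S, Finset.mem_union, Finset.mem_biUnion]
        exact Or.inr (Or.inr ⟨l, hl, hx⟩)
  · simp only [S, Finset.mem_union, Finset.mem_biUnion]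
    exact Or.inr (Or.inr ⟨l, hl, trStmts₁_self _⟩)

end LinkedData

namespace LinkedData

open Turing StateTransition Turing.PartrecToTM2

/-! ## A machine that alternates between computations and elementary actions -/

/-- The cells of the work tape, which holds the stacks of the stack machine. -/
abbrev StackCell : Type := TM2to1.Γ' K' (fun _ : K' => PartrecToTM2.Γ')

abbrev workTM1 : TM2to1.Λ' K' (fun _ : K' => PartrecToTM2.Γ') PartrecToTM2.Λ'
    (Option PartrecToTM2.Γ') → TM1.Stmt StackCell (TM2to1.Λ' K' (fun _ : K' => PartrecToTM2.Γ')
      PartrecToTM2.Λ' (Option PartrecToTM2.Γ')) (Option PartrecToTM2.Γ') :=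
  TM2to1.tr popTr

abbrev WorkState : Type := TM1to0.Λ' workTM1

abbrev workTM0 : TM0.Machine StackCell WorkState := TM1to0.tr workTM1

def labelState (q : PartrecToTM2.Λ') : WorkState := (some (workTM1 (TM2to1.Λ'.normal q)), none)

/-- States of a machine that runs the stack machine in the states `S`, together with a counter
below `N`; there are three additional states: the start state, the expand state, and a state in
which the link traversal tape is read. -/
abbrev CtrlState (S : Finset WorkState) (N : ℕ) : Type := Fin 3 ⊕ (Fin N × S)

open Classical in
/-- The state with counter `i` and state `q` of the stack machine. -/
noncomputable def enter (S : Finset WorkState) (N : ℕ) (i : ℕ) (q : WorkState) : CtrlState S N :=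
  -- The default only makes the definition total; the simulation stays within the bounds.
  if h : i < N ∧ q ∈ S then Sum.inr (⟨i, h.1⟩, ⟨q, h.2⟩) else Sum.inl 0

/-- The execution of a command. -/
def cmdAction (S : Finset WorkState) (N : ℕ) (γ : StackCell) (l : Option Sym) :
    Cmd → Action (CtrlState S N) StackCell
  | .nop => ⟨.inl 2, .stay, γ, .stay, l, .stay, none⟩
  | .write x => ⟨.inl 2, .stay, γ, .stay, some x, .right, none⟩
  | .output x => ⟨.inl 2, .stay, γ, .stay, l, .stay, some x⟩
  | .expand => ⟨.inl 1, .stay, γ, .stay, l, .stay, none⟩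
  | .advance => ⟨.inl 2, .stay, γ, .stay, l, .right, none⟩

/-- The machine computes with the code `c` on the work tape, where the symbol under the head of the
link traversal tape is a part of the input. Then it removes digits from the result up to the first
digit one. The number of removed zeros is the code of a command, which the machine executes. Then
it continues with what remains of the result. -/
noncomputable def ioMachine (c : ToPartrec.Code) (S : Finset WorkState) (N : ℕ) : LDMachine where
  State := CtrlState S N
  Γ := StackCell
  finite_state := inferInstance
  finite_Γ := Finite.of_fintype _
  inhabited_Γ := inferInstance
  start := .inl 0
  expand := .inl 1
  δ s _ γ l :=
    match s with
    | .inl k =>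
      if k = 0 then
        -- The pushed word represents the list `[0, 0]`: the codes of a blank cell and of an initial
        -- state with code zero. The cell written is the bottom mark of the empty stacks.
        some ⟨enter S N 0 (labelState (pushLabel (trNormal c Cont'.halt) [Γ'.cons, Γ'.cons])),
          .stay, (true, fun _ => none), .stay, l, .stay, none⟩
      -- The expand state shares this action: the scanned symbol is then the one present after the
      -- expansion.
      else some ⟨enter S N 0 (labelState (inputLabel c (Encodable.encode l))),
          .stay, γ, .stay, l, .stay, none⟩
    | .inr (i, q) =>
      match workTM0 q γ with
      | some (q', .move .left) => some ⟨enter S N i q', .stay, γ, .left, l, .stay, none⟩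
      | some (q', .move .right) => some ⟨enter S N i q', .stay, γ, .right, l, .stay, none⟩
      | some (q', .write a) => some ⟨enter S N i q', .stay, a, .stay, l, .stay, none⟩
      | none =>
        -- The stack machine has halted; its local variable, a component of the state, holds the
        -- digit just popped. On a digit other than one the counter goes up and the next digit is
        -- popped.
        if q.1.2 = some Γ'.bit1 then
          (Encodable.decode (α := Cmd) i).map (cmdAction S N γ l)
        else some ⟨enter S N (i + 1) (labelState (Λ'.ret Cont'.halt)),
          .stay, γ, .stay, l, .stay, none⟩

/-- The contents of the link traversal and output tapes. -/
structure IOConf : Type where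
  link : ℕ → Option Sym
  pos : ℕ
  out : List Sym

/-- The effect of a command. -/
noncomputable def IOConf.exec (U L : Type) [Encodable U] [Encodable L] (web : ℕ → Option Sym)
    (io : IOConf) : Cmd → IOConf
  | .nop => io
  | .write x => ⟨Function.update io.link io.pos (some x), io.pos + 1, io.out⟩
  | .output x => ⟨io.link, io.pos, io.out ++ [x]⟩
  | .expand => ⟨appendWord io.link (expansion U L web io.link), io.pos, io.out⟩
  | .advance => ⟨io.link, io.pos + 1, io.out⟩

/-! ### Steps of the LD machine as steps of the stack machine -/

section

variable {c : ToPartrec.Code} {S : Finset WorkState} {N : ℕ}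

noncomputable def toConfig (c : ToPartrec.Code) (S : Finset WorkState) (N : ℕ)
    (C : TM0.Cfg StackCell WorkState) (i : ℕ) (io : IOConf) : (ioMachine c S N).Config where
  state := enter S N i C.q
  inputPos := 0
  work := C.Tape
  link := io.link
  linkPos := io.pos
  output := io.out

theorem step_of_state_ne {U L : Type} [Encodable U] [Encodable L] (M : LDMachine)
    (input : ℤ → Option Sym) (web : ℕ → Option Sym) {C : M.Config} (h : C.state ≠ M.expand) :
    M.step U L input web C =
      (M.δ C.state (input C.inputPos) C.work.head (C.link C.linkPos)).map fun a =>
        { state := a.next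
          inputPos := a.inputMove.onInt C.inputPos
          work := a.workMove.onTape (C.work.write a.workWrite)
          link := Function.update C.link C.linkPos a.linkWrite
          linkPos := a.linkMove.onNat C.linkPos
          output := C.output ++ a.output.toList } := by
  simp only [LDMachine.step, LDMachine.prepare, if_neg h]

theorem enter_eq {i : ℕ} {q : WorkState} (hi : i < N) (hq : q ∈ S) :
    enter S N i q = Sum.inr (⟨i, hi⟩, ⟨q, hq⟩) := dif_pos ⟨hi, hq⟩

variable {U L : Type} [Encodable U] [Encodable L] {input : ℤ → Option Sym} {web : ℕ → Option Sym}

theorem step_toConfig {C : TM0.Cfg StackCell WorkState} {i : ℕ} {io : IOConf} (hi : i < N)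
    (hq : C.q ∈ S) :
    (ioMachine c S N).step U L input web (toConfig c S N C i io) =
      ((ioMachine c S N).δ (.inr (⟨i, hi⟩, ⟨C.q, hq⟩)) (input 0) C.Tape.head
        (io.link io.pos)).map fun a =>
        { state := a.next
          inputPos := a.inputMove.onInt 0
          work := a.workMove.onTape (C.Tape.write a.workWrite)
          link := Function.update io.link io.pos a.linkWrite
          linkPos := a.linkMove.onNat io.pos
          output := io.out ++ a.output.toList } := by
  rw [step_of_state_ne]
  · simp only [toConfig, enter_eq hi hq]
  · simp only [toConfig, enter_eq hi hq, ioMachine]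
    exact Sum.inr_ne_inl

theorem step_toConfig_of_step {C C' : TM0.Cfg StackCell WorkState} {i : ℕ} {io : IOConf}
    (hi : i < N) (hq : C.q ∈ S) (h : C' ∈ TM0.step workTM0 C) :
    (ioMachine c S N).step U L input web (toConfig c S N C i io) =
      some (toConfig c S N C' i io) := by
  rw [step_toConfig hi hq]
  obtain ⟨q, T⟩ := C
  simp only [TM0.step, Option.mem_def, Option.map_eq_some_iff] at h
  obtain ⟨⟨q', s⟩, h, rfl⟩ := h
  rcases s with (_ | _) | a <;>
    simp [ioMachine, h, toConfig, Move.onInt, Move.onNat, Move.onTape] <;> congr 1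

theorem reaches_toConfig {C C' : TM0.Cfg StackCell WorkState} {i : ℕ} {io : IOConf}
    (hS : TM0.Supports workTM0 (S : Set WorkState)) (hi : i < N) (hq : C.q ∈ S)
    (h : Reaches (TM0.step workTM0) C C') :
    C'.q ∈ S ∧ Reaches ((ioMachine c S N).step U L input web)
      (toConfig c S N C i io) (toConfig c S N C' i io) := by
  induction h with
  | refl => exact ⟨hq, .refl⟩
  | tail _ h ih =>
    exact ⟨TM0.step_supports _ hS h ih.1, ih.2.tail (step_toConfig_of_step hi ih.1 h)⟩

/-- The machine configuration `D` represents the stack machine configuration `b`. -/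
def Represents (c : ToPartrec.Code) (S : Finset WorkState) (N : ℕ) (b : StackCfg) (i : ℕ)
    (io : IOConf) (D : (ioMachine c S N).Config) : Prop :=
  ∃ C, TM2to1.TrCfg b C ∧ (TM1to0.trCfg workTM1 C).q ∈ S ∧
    D = toConfig c S N (TM1to0.trCfg workTM1 C) i io

/-- The translations from stacks to one tape and from statements to single moves respect runs; every
move of the resulting machine is one ordinary LD step that leaves counter, link traversal tape and
output alone. -/
theorem Represents.reaches {b b' : StackCfg} {i : ℕ} {io : IOConf} {D : (ioMachine c S N).Config}
    (hS : TM0.Supports workTM0 (S : Set WorkState)) (hi : i < N)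
    (hD : Represents c S N b i io D) (h : Reaches (TM2.step popTr) b b') :
    ∃ D', Reaches ((ioMachine c S N).step U L input web) D D' ∧ Represents c S N b' i io D' := by
  obtain ⟨C, hC, hq, rfl⟩ := hD
  obtain ⟨C', hC', h'⟩ := tr_reaches (TM2to1.tr_respects popTr) hC h
  obtain ⟨_, rfl, h''⟩ := tr_reaches (TM1to0.tr_respects workTM1) rfl h'
  obtain ⟨hq', hr⟩ := reaches_toConfig (c := c) (U := U) (L := L) (input := input)
    (web := web) (io := io) hS hi hq h''
  exact ⟨_, hr, C', hC', hq', rfl⟩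

theorem Represents.pop {v : Option PartrecToTM2.Γ'} {s : K' → List PartrecToTM2.Γ'} {i : ℕ}
    {io : IOConf} {D : (ioMachine c S N).Config} (hi : i + 1 < N)
    (hS : labelState (Λ'.ret Cont'.halt) ∈ S)
    (hD : Represents c S N ⟨none, v, s⟩ i io D) (hv : v ≠ some Γ'.bit1) :
    ∃ D', (ioMachine c S N).step U L input web D = some D' ∧
      Represents c S N ⟨some (Λ'.ret Cont'.halt), none, s⟩ (i + 1) io D' := by
  obtain ⟨C, hC, hq, rfl⟩ := hD
  cases hC with
  | mk l hl =>
  refine ⟨_, ?_, _, ⟨l, hl⟩, hS, rfl⟩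
  rw [step_toConfig (by omega) hq]
  simp [ioMachine, TM1to0.trCfg, TM1to0.tr, hv, toConfig, labelState, Move.onInt, Move.onNat,
    Move.onTape]
  congr 1

theorem Represents.exec {s : K' → List PartrecToTM2.Γ'} {i : ℕ} {io : IOConf} {cmd : Cmd}
    {D : (ioMachine c S N).Config} (hi : i < N) (hcmd : Encodable.decode (α := Cmd) i = some cmd)
    (hS : ∀ l : Option Sym, labelState (inputLabel c (Encodable.encode l)) ∈ S)
    (hD : Represents c S N ⟨none, some Γ'.bit1, s⟩ i io D) :
    ∃ D', Reaches₁ ((ioMachine c S N).step U L input web) D D' ∧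
      Represents c S N ⟨some (inputLabel c (Encodable.encode
        ((io.exec U L web cmd).link (io.exec U L web cmd).pos))), none, s⟩ 0
          (io.exec U L web cmd) D' := by
  obtain ⟨C, hC, hq, rfl⟩ := hD
  cases hC with
  | mk l hl =>
  refine ⟨_, ?_, _, ⟨l, hl⟩, hS _, rfl⟩
  let a := cmdAction S N (Tape.mk' ∅ (TM2to1.addBottom l)).head (io.link io.pos) cmd
  -- The configuration between the two steps: the command has been issued, and the machine is in the
  -- reading or the expand state.
  let D₁ : (ioMachine c S N).Config := 
    { state := a.next
      inputPos := 0
      work := Tape.mk' ∅ (TM2to1.addBottom l)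
      link := Function.update io.link io.pos a.linkWrite
      linkPos := a.linkMove.onNat io.pos
      output := io.out ++ a.output.toList }
  refine Relation.TransGen.tail (.single (b := D₁) ?_) ?_
  · change _ = _ 
    rw [step_toConfig hi hq]
    cases cmd <;>
      simp [ioMachine, TM1to0.trCfg, TM1to0.tr, hcmd, cmdAction, Move.onInt, Move.onTape, D₁, a] <;>
      congr 1
  · change _ = _
    cases cmd with
    | expand =>
      simp [LDMachine.step, LDMachine.prepare, D₁, a, cmdAction, ioMachine, IOConf.exec, toConfig,
        Move.onInt, Move.onNat, Move.onTape, TM1to0.trCfg, labelState]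
      congr 1
    | _ =>
      rw [step_of_state_ne _ _ _ (by simp [D₁, a, cmdAction, ioMachine])]
      simp [D₁, a, cmdAction, ioMachine, IOConf.exec, toConfig, Move.onInt, Move.onNat,
        Move.onTape, TM1to0.trCfg, labelState]
      congr 1
      all_goals exact Function.update_eq_iff.2 ⟨by simp, fun _ _ => rfl⟩

end

end LinkedData

namespace LinkedData

open Turing StateTransition Turing.PartrecToTM2

/-! ## Simulation of interactive processes -/

theorem step_popTr_ret_halt (v : Option PartrecToTM2.Γ') (g : PartrecToTM2.Γ')
    (l : List PartrecToTM2.Γ') :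
    TM2.step popTr ⟨some (Λ'.ret Cont'.halt), v, K'.elim (g :: l) [] [] []⟩ =
      some ⟨none, some g, K'.elim l [] [] []⟩ := by
  simp [TM2.step, popTr_ret_halt]

/-- Decoding of a result: the `r` low zeros are counted, the digit one ends the count, and the stack
keeps the remaining factor `m`. -/
theorem Represents.pop_zeros {c : ToPartrec.Code} {S : Finset WorkState} {N : ℕ} {U L : Type}
    [Encodable U] [Encodable L] {input : ℤ → Option Sym} {web : ℕ → Option Sym}
    (hS : TM0.Supports workTM0 (S : Set WorkState)) (hr : labelState (Λ'.ret Cont'.halt) ∈ S)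
    (m r : ℕ) {j : ℕ} {v : Option PartrecToTM2.Γ'} {io : IOConf} {D : (ioMachine c S N).Config}
    (hj : j + r < N)
    (hD : Represents c S N ⟨some (Λ'.ret Cont'.halt), v,
      K'.elim (trList [2 ^ r * (2 * m + 1)]) [] [] []⟩ j io D) :
    ∃ D', Reaches ((ioMachine c S N).step U L input web) D D' ∧
      Represents c S N ⟨none, some Γ'.bit1, K'.elim (trList [m]) [] [] []⟩ (j + r) io D' := by
  induction r generalizing j v D with
  | zero =>
    refine hD.reaches hS (by omega) (.single ?_)
    rw [pow_zero, one_mul, trList, trNat_two_mul_add_one]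
    exact step_popTr_ret_halt _ _ _
  | succ r ih =>
    have h : trList [2 ^ (r + 1) * (2 * m + 1)] = Γ'.bit0 :: trList [2 ^ r * (2 * m + 1)] := by
      rw [pow_succ', mul_assoc, trList, trNat_two_mul (by positivity)]
      rfl
    rw [h] at hD
    obtain ⟨D₁, h₁, hD₁⟩ := hD.reaches (U := U) (L := L) (input := input) (web := web) hS (by omega)
      (.single (step_popTr_ret_halt _ _ _))
    obtain ⟨D₂, h₂, hD₂⟩ := hD₁.pop (U := U) (L := L) (input := input) (web := web) (by omega) hr
      (by simp)
    obtain ⟨D₃, h₃, hD₃⟩ := ih (by omega) hD₂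
    exact ⟨D₃, (h₁.tail h₂).trans h₃, by rwa [add_assoc, add_comm 1] at hD₃⟩

/-- One positive number carries the pair of new state and command, so that the command can be read
off digit by digit with a bounded counter. -/
theorem exists_code_of_computable {σ : Type} [Primcodable σ] {F : σ × Option Sym → σ × Cmd}
    (hF : Computable F) (s₀ : σ) :
    ∃ c : ToPartrec.Code, ∀ (s : σ) (a : Option Sym),
      c.eval [Encodable.encode a, Encodable.encode s] =
        pure [2 ^ Encodable.encode (F (s, a)).2 * (2 * Encodable.encode (F (s, a)).1 + 1)] := by
  let g : ℕ → ℕ → ℕ := fun a m =>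
    -- The defaults make `g` total and are not used on codes.
    let r := F ((Encodable.decode m).getD s₀, (Encodable.decode a).getD none)
    2 ^ Encodable.encode r.2 * (2 * Encodable.encode r.1 + 1)
  have hg : Computable₂ g := by
    have hr : Computable fun x : ℕ × ℕ =>
        F ((Encodable.decode x.2).getD s₀, (Encodable.decode x.1).getD none) :=
      hF.comp (((Computable.decode.comp .snd).option_getD (.const s₀)).pair
        ((Computable.decode.comp .fst).option_getD (.const none)))
    have h2 : Computable fun c : Cmd => 2 ^ Encodable.encode c := (Primrec.dom_finite _).to_comp
    exact Primrec.nat_mul.to_comp.comp (h2.comp (Computable.snd.comp hr))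
      (Primrec.nat_double_succ.to_comp.comp (Computable.encode.comp (Computable.fst.comp hr)))
  obtain ⟨c, hc⟩ := ToPartrec.Code.exists_code (Nat.Partrec'.part_iff₂.2 hg.partrec₂)
  refine ⟨c, fun s a => ?_⟩
  have h := hc ⟨[Encodable.encode a, Encodable.encode s], rfl⟩
  refine h.trans ?_
  have : g (Encodable.encode a) (Encodable.encode s) =
      2 ^ Encodable.encode (F (s, a)).2 * (2 * Encodable.encode (F (s, a)).1 + 1) := by
    simp [g]
  rw [← this]
  exact Part.map_some _ _

/-- A step of a process with transition function `F`: the process sees the symbol under the head of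
the link traversal tape and determines the next command. -/
noncomputable def procStep {σ : Type} (U L : Type) [Encodable U] [Encodable L]
    (F : σ × Option Sym → σ × Cmd) (web : ℕ → Option Sym) (p : σ × IOConf) : σ × IOConf :=
  ((F (p.1, p.2.link p.2.pos)).1, p.2.exec U L web (F (p.1, p.2.link p.2.pos)).2)

/-- The run of a process with transition function `F`. -/
noncomputable def procRun {σ : Type} (U L : Type) [Encodable U] [Encodable L]
    (F : σ × Option Sym → σ × Cmd) (s₀ : σ) (web : ℕ → Option Sym) (n : ℕ) : σ × IOConf :=
  (procStep U L F web)^[n] (s₀, ⟨fun _ => none, 0, []⟩)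

theorem exists_finset_supports (c : ToPartrec.Code) : ∃ S : Finset WorkState,
    TM0.Supports workTM0 (S : Set WorkState) ∧ labelState (Λ'.ret Cont'.halt) ∈ S ∧
    labelState (pushLabel (trNormal c Cont'.halt) [Γ'.cons, Γ'.cons]) ∈ S ∧
    ∀ l : Option Sym, labelState (inputLabel c (Encodable.encode l)) ∈ S := by
  classical
  obtain ⟨S, hS, h₁, h₂⟩ := exists_popTr_supports c (insert [Γ'.cons, Γ'.cons]
    (Finset.univ.image fun l : Option Sym => trNat (Encodable.encode l) ++ [Γ'.cons]))
  have key : ∀ q ∈ S, labelState q ∈ TM1to0.trStmts workTM1 (TM2to1.trSupp popTr S) := by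
    intro q hq
    simp only [TM1to0.trStmts, labelState]
    refine Finset.mem_product.2 ⟨?_, Finset.mem_univ _⟩
    simp only [TM1.stmts, Finset.some_mem_insertNone, Finset.mem_biUnion]
    exact ⟨_, Finset.mem_biUnion.2 ⟨q, hq, Finset.mem_insert_self _ _⟩, TM1.stmts₁_self⟩
  refine ⟨_, TM1to0.tr_supports workTM1 (TM2to1.tr_supports popTr hS), key _ h₁,
    key _ (h₂ _ (by simp)), fun l => key _ (h₂ _ ?_)⟩
  exact Finset.mem_insert_of_mem (Finset.mem_image_of_mem _ (Finset.mem_univ _))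

/-! ### Runs and outputs of LD machines -/

section

variable {U L : Type} [Denumerable U] [Denumerable L]

theorem exists_run_of_reaches (M : LDMachine) (W : Web U L) {D : M.Config} {n : ℕ}
    (h : Reaches (M.step U L (inputTape []) (webTape W)) (M.run [] W n) D) :
    ∃ n' ≥ n, M.run [] W n' = D := by
  induction h with
  | refl => exact ⟨n, le_rfl, rfl⟩
  | tail _ h ih =>
    obtain ⟨n', hn', rfl⟩ := ih
    refine ⟨n' + 1, by omega, ?_⟩
    rw [LDMachine.run, Option.mem_def.1 h, Option.getD_some]

/-- Strict progress is needed to show that `k` steps of a process take at least `k` machine steps.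
-/
theorem exists_run_of_reaches₁ (M : LDMachine) (W : Web U L) {D : M.Config} {n : ℕ}
    (h : Reaches₁ (M.step U L (inputTape []) (webTape W)) (M.run [] W n) D) :
    ∃ n' > n, M.run [] W n' = D := by
  obtain ⟨D₁, h₁, h₂⟩ := Relation.TransGen.head'_iff.1 h
  have h₃ : M.run [] W (n + 1) = D₁ := by
    rw [LDMachine.run, Option.mem_def.1 h₁, Option.getD_some]
  obtain ⟨n', hn', h₄⟩ := exists_run_of_reaches M W (n := n + 1) (h₃ ▸ h₂)
  exact ⟨n', hn', h₄⟩

theorem output_prefix_succ (M : LDMachine) (W : Web U L) (n : ℕ) :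
    (M.run [] W n).output <+: (M.run [] W (n + 1)).output := by
  rw [LDMachine.run]
  cases h : M.step U L (inputTape []) (webTape W) (M.run [] W n) with
  | none => simp
  | some D =>
    simp only [LDMachine.step, Option.map_eq_some_iff] at h
    obtain ⟨a, -, rfl⟩ := h
    have : (M.prepare U L (webTape W) (M.run [] W n)).output = (M.run [] W n).output := by
      unfold LDMachine.prepare; split_ifs <;> rfl
    simp [this]

theorem output_prefix_of_le (M : LDMachine) (W : Web U L) {m n : ℕ} (h : m ≤ n) :
    (M.run [] W m).output <+: (M.run [] W n).output := by
  induction n, h using Nat.le_induction with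
  | base => exact List.prefix_rfl
  | succ n _ ih => exact ih.trans (output_prefix_succ M W n)

end

/-- Every computable process is carried out by an LD machine. -/
theorem exists_machine_of_computable {σ : Type} [Primcodable σ] {F : σ × Option Sym → σ × Cmd}
    (hF : Computable F) (s₀ : σ) (h₀ : Encodable.encode s₀ = 0) :
    ∃ M : LDMachine, ∀ (U L : Type) [Denumerable U] [Denumerable L] (W : Web U L) (k : ℕ),
      ∃ n ≥ k, (M.run [] W n).output = (procRun U L F s₀ (webTape W) k).2.out := by
  obtain ⟨c, hc⟩ := exists_code_of_computable hF s₀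
  obtain ⟨S, hS, hr, hi, hl⟩ := exists_finset_supports c
  obtain ⟨N, hN⟩ : ∃ N : ℕ, ∀ cmd : Cmd, Encodable.encode cmd < N := by
    obtain ⟨N, hN⟩ := (Set.finite_range (Encodable.encode : Cmd → ℕ)).bddAbove
    exact ⟨N + 1, fun cmd => Nat.lt_succ_of_le (hN ⟨cmd, rfl⟩)⟩
  have hN0 : 0 < N := (Nat.zero_le _).trans_lt (hN .nop)
  refine ⟨ioMachine c S N, fun U L _ _ W k => ?_⟩
  -- Invariant: after `k` steps of the process the machine is about to run `c` on the codes of the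
  -- scanned symbol and of the current state.
  suffices h : ∃ n ≥ k, Represents c S N
      (init c [Encodable.encode ((procRun U L F s₀ (webTape W) k).2.link
        (procRun U L F s₀ (webTape W) k).2.pos),
        Encodable.encode (procRun U L F s₀ (webTape W) k).1]) 0
      (procRun U L F s₀ (webTape W) k).2 ((ioMachine c S N).run [] W n) by
    obtain ⟨n, hn, C, -, -, h⟩ := h
    exact ⟨n, hn, by rw [h]; rfl⟩
  induction k with
  | zero =>
    let C : TM2.Cfg (fun _ : K' => PartrecToTM2.Γ') PartrecToTM2.Λ' (Option PartrecToTM2.Γ') :=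
      ⟨some (pushLabel (trNormal c Cont'.halt) [Γ'.cons, Γ'.cons]), none, K'.elim [] [] [] []⟩
    have hD : ∃ D, (ioMachine c S N).step U L (inputTape []) (webTape W)
        ((ioMachine c S N).run [] W 0) = some D ∧
        Represents c S N C 0 ⟨fun _ => none, 0, []⟩ D := by
      refine ⟨_, ?_, _, ⟨ListBlank.mk [], fun k => ?_⟩, hi, rfl⟩
      · rw [step_of_state_ne]
        · simp [LDMachine.run, LDMachine.init, ioMachine, toConfig, TM1to0.trCfg, labelState,
            Move.onInt, Move.onNat, Move.onTape]
          rfl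
        · simp [LDMachine.run, LDMachine.init, ioMachine]
      · cases k <;> rfl
    obtain ⟨D, h, hD⟩ := hD
    obtain ⟨D', h', hD'⟩ := hD.reaches (U := U) (L := L) (input := inputTape []) (web := webTape W)
      hS hN0 (pushLabel_reaches _ _ _ _)
    obtain ⟨n, hn, rfl⟩ := exists_run_of_reaches _ W (n := 0) (.head h h')
    refine ⟨n, hn, ?_⟩
    simpa [procRun, h₀, init] using hD'
  | succ k ih =>
    obtain ⟨n, hn, h⟩ := ih
    rw [procRun, Function.iterate_succ_apply', ← procRun]
    set p := procRun U L F s₀ (webTape W) k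
    obtain ⟨s, hs⟩ := code_reaches (hc p.1 (p.2.link p.2.pos))
    obtain ⟨D₁, r₁, h₁⟩ := h.reaches (U := U) (L := L) (input := inputTape []) (web := webTape W)
      hS hN0 hs
    obtain ⟨D₂, r₂, h₂⟩ := h₁.pop_zeros (U := U) (L := L) (input := inputTape [])
      (web := webTape W) hS hr _ _ (by rw [zero_add]; exact hN _)
    rw [zero_add] at h₂
    obtain ⟨D₃, r₃, h₃⟩ := h₂.exec (U := U) (L := L) (input := inputTape [])
      (web := webTape W) (hN _) (Encodable.encodek _) hl
    obtain ⟨D₄, r₄, h₄⟩ := h₃.reaches (U := U) (L := L) (input := inputTape [])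
      (web := webTape W) hS hN0 (inputLabel_reaches _ _ _)
    -- One round: compute, count the zeros, execute the command, push the newly scanned symbol. The
    -- execution is the part that surely takes a step.
    obtain ⟨n', hn', rfl⟩ := exists_run_of_reaches₁ _ W
      ((Relation.TransGen.trans_right (r₁.trans r₂) r₃).trans_left r₄)
    exact ⟨n', by omega, h₄⟩

end LinkedData

namespace LinkedData

/-! ## Reading documents -/

/-- The components of a data triple. -/
def tripleRow {U L : Type} (t : Triple U L) : List (U ⊕ L) := [Sum.inl t.1, Sum.inl t.2.1, t.2.2]

theorem tripleRow_injective {U L : Type} :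
    Function.Injective (tripleRow : Triple U L → List (U ⊕ L)) := by
  rintro ⟨s, p, o⟩ ⟨s', p', o'⟩ h
  simpa [tripleRow] using h

section

variable {U L : Type} [Denumerable U] [Denumerable L]

/-- Reading a word from right to left: the current number, the components of the current data
triple, and the data triples. -/
def readSym (x : Sym) (st : ℕ × List (U ⊕ L) × List (List (U ⊕ L))) :
    ℕ × List (U ⊕ L) × List (List (U ⊕ L)) :=
  match x with
  | .bit b => (Nat.bit b st.1, st.2)
  | .ident => (0, Sum.inl (Denumerable.ofNat U st.1) :: st.2.1, st.2.2)
  | .lit => (0, Sum.inr (Denumerable.ofNat L st.1) :: st.2.1, st.2.2)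
  | .langle => (0, [], st.2.1 :: st.2.2)
  | _ => st

/-- Markers and opening brackets precede what they announce. Reading from the right, a number is
complete when its marker is met, and a row when its bracket is met. -/
def readWord (U L : Type) [Denumerable U] [Denumerable L] (w : List Sym) : List (List (U ⊕ L)) :=
  (w.foldr readSym (0, [], [])).2.2

/-- The lowest digit stands first, so a fold from the right starts at the highest digit and rebuilds
the number with `Nat.bit`. -/
theorem foldr_readSym_bits (n : ℕ) (c : List (U ⊕ L)) (r : List (List (U ⊕ L))) :
    ((Nat.bits n).map Sym.bit).foldr readSym (0, c, r) = (n, c, r) := by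
  induction n using Nat.binaryRec' with
  | zero => simp
  | bit b n h ih => rw [Nat.bits_append_bit _ _ h, List.map_cons, List.foldr_cons, ih]; rfl

theorem foldr_readSym_encId (u : U) (c : List (U ⊕ L)) (r : List (List (U ⊕ L))) :
    (encId u).foldr readSym (0, c, r) = (0, Sum.inl u :: c, r) := by
  simp [encId, encBinary, foldr_readSym_bits, readSym]

theorem foldr_readSym_encConst (x : U ⊕ L) (c : List (U ⊕ L)) (r : List (List (U ⊕ L))) :
    (encConst x).foldr readSym (0, c, r) = (0, x :: c, r) := by
  cases x with
  | inl u => exact foldr_readSym_encId u c r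
  | inr l => simp [encConst, encLit, encBinary, foldr_readSym_bits, readSym]

theorem foldr_readSym_encTriple (t : Triple U L) (r : List (List (U ⊕ L))) :
    (encTriple t).foldr readSym (0, [], r) = (0, [], tripleRow t :: r) := by
  have h (x : Sym) (hx : x = .comma ∨ x = .rangle) (st : ℕ × List (U ⊕ L) × List (List (U ⊕ L))) :
      readSym x st = st := by rcases hx with rfl | rfl <;> rfl
  simp only [encTriple, List.foldr_cons, List.foldr_append, List.foldr_nil, h .comma (.inl rfl),
    h .rangle (.inr rfl), foldr_readSym_encId, foldr_readSym_encConst]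
  rfl

theorem foldr_readSym_intercalate (l : List (Triple U L)) (r : List (List (U ⊕ L))) :
    ([Sym.comma].intercalate (l.map encTriple)).foldr readSym (0, [], r) =
      (0, [], l.map tripleRow ++ r) := by
  induction l with
  | nil => rfl
  | cons t l ih =>
    cases l with
    | nil => simp [foldr_readSym_encTriple]
    | cons t' l =>
      simp only [List.map_cons] at ih
      rw [List.map_cons, List.map_cons, List.intercalate_cons_cons, List.foldr_append,
        List.foldr_append, ih]
      exact foldr_readSym_encTriple t _

theorem readWord_encTriples (T : Finset (Triple U L)) :
    readWord U L (encTriples T) = (T.sort (tripleKey U L ⁻¹'o (· ≤ ·))).map tripleRow := by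
  have h (x : Sym) (hx : x = .llangle ∨ x = .rrangle)
      (st : ℕ × List (U ⊕ L) × List (List (U ⊕ L))) :
      readSym x st = st := by rcases hx with rfl | rfl <;> rfl
  simp only [readWord, encTriples, encList, List.foldr_cons, List.foldr_append, List.foldr_nil,
    h .llangle (.inl rfl), h .rrangle (.inr rfl), foldr_readSym_intercalate, List.append_nil]

theorem encTriples_injective :
    Function.Injective (encTriples : Finset (Triple U L) → List Sym) := by
  classical
  intro T T' h
  have h' := congrArg (readWord U L) h
  rw [readWord_encTriples, readWord_encTriples] at h'
  have := congrArg List.toFinset (tripleRow_injective.list_map h')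
  simpa using this

theorem encBinary_injective {α : Type} [Denumerable α] :
    Function.Injective (encBinary : α → List Sym) := by
  intro a b h
  have h' := congrArg (fun w : List Sym => (w.foldr (readSym (U := ℕ) (L := ℕ)) (0, [], [])).1) h
  simp only [encBinary, foldr_readSym_bits] at h'
  exact Encodable.encode_injective h'

end

/-! ## The words on the Web tape -/

theorem append_cons_inj_left {α : Type} {a : α} {x x' z z' : List α} (hx : a ∉ x) (hx' : a ∉ x')
    (h : x ++ a :: z = x' ++ a :: z') : x = x' ∧ z = z' := by
  induction x generalizing x' with
  | nil =>
    cases x' with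
    | nil => simpa using h
    | cons b x' => simp at h hx'; exact absurd h.1 hx'.1
  | cons c x ih =>
    cases x' with
    | nil => simp at h hx; exact absurd h.1.symm hx.1
    | cons b x' =>
      simp only [List.cons_append, List.cons.injEq, List.mem_cons, not_or] at h hx hx'
      obtain ⟨rfl, rfl⟩ := ih hx.2 hx'.2 h.2
      exact ⟨by rw [h.1], rfl⟩

theorem append_cons_inj_right {α : Type} {a : α} {x x' z z' : List α} (hz : a ∉ z) (hz' : a ∉ z')
    (h : x ++ a :: z = x' ++ a :: z') : x = x' ∧ z = z' := by
  have h' := congrArg List.reverse h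
  simp only [List.reverse_append, List.reverse_cons, List.append_assoc, List.singleton_append] at h'
  obtain ⟨h₁, h₂⟩ := append_cons_inj_left (by simpa using hz) (by simpa using hz') h'
  exact ⟨List.reverse_injective h₂, List.reverse_injective h₁⟩

section

variable {U L : Type} [Denumerable U] [Denumerable L]

theorem mem_encBinary {α : Type} [Encodable α] {a : α} {x : Sym} (h : x ∈ encBinary a) :
    ∃ b, x = .bit b := by
  simp only [encBinary, List.mem_map] at h
  obtain ⟨b, -, rfl⟩ := h
  exact ⟨b, rfl⟩

theorem sharp_notMem_encId (u : U) : Sym.sharp ∉ encId u := by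
  intro h
  rcases List.mem_cons.1 h with h | h
  · cases h
  · obtain ⟨b, h⟩ := mem_encBinary h
    cases h

theorem sharp_notMem_encConst (x : U ⊕ L) : Sym.sharp ∉ encConst x := by
  cases x with
  | inl u => exact sharp_notMem_encId u
  | inr l =>
    intro h
    rcases List.mem_cons.1 h with h | h
    · cases h
    · obtain ⟨b, h⟩ := mem_encBinary h
      cases h

theorem sharp_notMem_encTriple (t : Triple U L) : Sym.sharp ∉ encTriple t := by
  simp [encTriple, sharp_notMem_encId, sharp_notMem_encConst]

theorem notMem_intercalate_comma {ws : List (List Sym)} (h : ∀ w ∈ ws, Sym.sharp ∉ w) :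
    Sym.sharp ∉ [Sym.comma].intercalate ws := by
  induction ws with
  | nil => simp
  | cons w ws ih =>
    cases ws with
    | nil => simpa using h
    | cons w' ws =>
      rw [List.intercalate_cons_cons]
      have := ih fun w hw => h w (by simp [hw])
      simp [h w, this]

theorem sharp_notMem_encTriples (T : Finset (Triple U L)) : Sym.sharp ∉ encTriples T := by
  have h : Sym.sharp ∉ [Sym.comma].intercalate
      ((T.sort (tripleKey U L ⁻¹'o (· ≤ ·))).map encTriple) := by
    refine notMem_intercalate_comma fun w hw => ?_
    obtain ⟨t, -, rfl⟩ := List.mem_map.1 hw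
    exact sharp_notMem_encTriple t
  simp [encTriples, encList, h]

/-- The first `llangle` marks where the identifier ends and the document begins. -/
theorem encId_append_encTriples_inj {u u' : U} {T T' : Finset (Triple U L)}
    (h : encId u ++ encTriples T = encId u' ++ encTriples T') : u = u' ∧ T = T' := by
  have hn (u : U) : Sym.llangle ∉ encId u := by
    intro h
    rcases List.mem_cons.1 h with h | h
    · cases h
    · obtain ⟨b, h⟩ := mem_encBinary h
      cases h
  obtain ⟨h₁, h₂⟩ := append_cons_inj_left (hn u) (hn u') h
  refine ⟨encBinary_injective (List.cons.inj h₁).2, encTriples_injective (L := L) ?_⟩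
  exact congrArg (List.cons Sym.llangle) h₂

/-- Both identifiers begin at the last `ident` of the word, since numerals contain no marker. -/
theorem eq_of_suffix {u u' : U} {w : List Sym} (h : encId u <:+ w ++ encId u') : u = u' := by
  obtain ⟨v, h⟩ := h
  have hn (u : U) : Sym.ident ∉ encBinary u := by
    intro h
    obtain ⟨b, h⟩ := mem_encBinary h
    cases h
  exact encBinary_injective (append_cons_inj_right (hn u) (hn u') h).2

/-- The part of the encoding of a Web that belongs to the identifier with index `i`. -/
def webBlock (W : Web U L) (i : ℕ) : List Sym :=
  match W.adoc (Denumerable.ofNat U i) with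
  | none => []
  | some d => encId (Denumerable.ofNat U i) ++ encTriples (W.data d) ++ [Sym.sharp]

theorem webPrefix_succ (W : Web U L) (n : ℕ) :
    webPrefix W (n + 1) = webPrefix W n ++ webBlock W n := by
  simp only [webPrefix, List.range_succ, List.flatMap_append, List.cons_append,
    List.flatMap_singleton]
  rfl

theorem webPrefix_prefix (W : Web U L) {m n : ℕ} (h : m ≤ n) :
    webPrefix W m <+: webPrefix W n := by
  induction n, h using Nat.le_induction with
  | base => exact List.prefix_rfl
  | succ n _ ih => exact ih.trans (by rw [webPrefix_succ]; exact List.prefix_append _ _)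

theorem exists_webPrefix_eq (W : Web U L) (n : ℕ) : ∃ w, webPrefix W n = w ++ [Sym.sharp] := by
  induction n with
  | zero => exact ⟨[], rfl⟩
  | succ n ih =>
    rw [webPrefix_succ, webBlock]
    cases W.adoc (Denumerable.ofNat U n) with
    | none => simpa using ih
    | some d => exact ⟨_, (List.append_assoc _ _ _).symm⟩

theorem webTape_eq (W : Web U L) {n k : ℕ} (h : k < (webPrefix W n).length) :
    webTape W k = (webPrefix W n)[k]? := by
  classical
  have hex : ∃ n, k < (webPrefix W n).length := ⟨n, h⟩
  rw [webTape, dif_pos hex]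
  obtain ⟨v, hv⟩ := webPrefix_prefix W (Nat.find_min' hex h)
  rw [← hv, List.getElem?_append_left (Nat.find_spec hex)]

theorem tapeContains_webTape (W : Web U L) {w : List Sym} (hw : w ≠ []) :
    TapeContains (webTape W) w ↔ ∃ n, w <:+: webPrefix W n := by
  constructor
  · rintro ⟨k, hk⟩
    have hlen : 0 < w.length := List.length_pos_iff.2 hw
    have hlast := hk (w.length - 1) (by omega)
    rw [List.getElem?_eq_getElem (by omega)] at hlast
    -- The last symbol of `w` is not blank, so its cell already belongs to a finite prefix.
    obtain ⟨n, hn⟩ : ∃ n, k + (w.length - 1) < (webPrefix W n).length := by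
      by_contra hne
      rw [webTape, dif_neg hne] at hlast
      cases hlast
    refine ⟨n, (webPrefix W n).take k, (webPrefix W n).drop (k + w.length), ?_⟩
    have h : w = ((webPrefix W n).drop k).take w.length := by
      refine List.ext_getElem? fun i => ?_
      by_cases hi : i < w.length
      · rw [List.getElem?_take_of_lt hi, List.getElem?_drop, ← hk i hi,
          webTape_eq W (n := n) (by omega)]
      · rw [List.getElem?_eq_none (by omega), List.getElem?_eq_none (by simp; omega)]
    conv_lhs => rw [h]
    rw [List.append_assoc, ← List.drop_drop, List.length_take, List.length_drop]
    rw [min_eq_left (by omega), List.take_append_drop, List.take_append_drop]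
  · rintro ⟨n, a, b, h⟩
    refine ⟨a.length, fun i hi => ?_⟩
    rw [webTape_eq W (n := n) (by rw [← h]; simp; omega), ← h, List.append_assoc,
      List.getElem?_append_right (by omega), List.getElem?_append_left (by omega)]
    simp

theorem infix_webPrefix (W : Web U L) {u : U} {d : W.D} (h : W.adoc u = some d) :
    [Sym.sharp] ++ encId u ++ encTriples (W.data d) ++ [Sym.sharp] <:+:
      webPrefix W (Encodable.encode u + 1) := by
  obtain ⟨w, hw⟩ := exists_webPrefix_eq W (Encodable.encode u)
  rw [webPrefix_succ, hw, webBlock, Denumerable.ofNat_encode, h]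
  exact ⟨w, [], by simp⟩

/-- Blocks contain `♯` only as their last symbol, so a word between two consecutive `♯` is exactly
one block. An occurrence that ends at the end of the prefix is the last nonempty block; any other
one lies in a shorter prefix. -/
theorem exists_of_infix_webPrefix (W : Web U L) {x : List Sym} (hx : Sym.sharp ∉ x) {n : ℕ}
    (h : Sym.sharp :: x ++ [Sym.sharp] <:+: webPrefix W n) :
    ∃ u d, W.adoc u = some d ∧ x = encId u ++ encTriples (W.data d) := by
  induction n with
  | zero =>
    have := h.length_le
    simp [webPrefix] at this
  | succ n ih =>
    rw [webPrefix_succ] at h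
    cases hd : W.adoc (Denumerable.ofNat U n) with
    | none => exact ih (by simpa [webBlock, hd] using h)
    | some d =>
      obtain ⟨a, b, h⟩ := h
      simp only [webBlock, hd] at h
      have hbody : Sym.sharp ∉ encId (Denumerable.ofNat U n) ++ encTriples (W.data d) := by
        simp [sharp_notMem_encId, sharp_notMem_encTriples]
      generalize hB : encId (Denumerable.ofNat U n) ++ encTriples (W.data d) = B at *
      rcases List.eq_nil_or_concat b with rfl | ⟨b, c, rfl⟩
      · obtain ⟨P, hP⟩ := exists_webPrefix_eq W n
        rw [hP] at h
        have h' : a ++ Sym.sharp :: x = P ++ Sym.sharp :: B := by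
          have : (a ++ Sym.sharp :: x) ++ [Sym.sharp] = (P ++ Sym.sharp :: B) ++ [Sym.sharp] := by
            simpa using h
          exact List.append_cancel_right this
        exact ⟨_, d, hd, by rw [hB]; exact (append_cons_inj_right hx hbody h').2⟩
      · have h' : webPrefix W n ++ B = (a ++ (Sym.sharp :: x ++ [Sym.sharp])) ++ b := by
          have : (a ++ (Sym.sharp :: x ++ [Sym.sharp]) ++ b) ++ [c] =
              (webPrefix W n ++ B) ++ [Sym.sharp] := by simpa using h
          exact (List.append_inj' this rfl).1.symm
        rcases List.append_eq_append_iff.1 h' with ⟨e, h₁, h₂⟩ | ⟨e, h₁, h₂⟩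
        · rcases List.eq_nil_or_concat e with rfl | ⟨e, c', rfl⟩
          · exact ih ⟨a, [], by simpa using h₁⟩
          · have : c' = Sym.sharp := by
              have h₃ : (a ++ Sym.sharp :: x) ++ [Sym.sharp] = (webPrefix W n ++ e) ++ [c'] := by
                simpa using h₁
              simpa using (List.append_inj' h₃ rfl).2.symm
            subst this
            exact absurd (by rw [h₂]; simp) hbody
        · exact ih ⟨a, e, h₁.symm⟩

/-! ### The expand procedure on a tape that holds a finite word -/

theorem wordLength_getElem? (w : List Sym) : wordLength (fun i => w[i]?) = w.length := by
  refine le_antisymm (Nat.sInf_le fun m hm => List.getElem?_eq_none hm) ?_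
  refine le_csInf ⟨w.length, fun m hm => List.getElem?_eq_none hm⟩ fun n hn => ?_
  exact List.getElem?_eq_none_iff.1 (hn n le_rfl)

theorem tapeWord_getElem? (w : List Sym) : tapeWord (fun i => w[i]?) = w.map some := by
  rw [tapeWord, wordLength_getElem?]
  refine List.ext_getElem (by simp) fun i h₁ h₂ => ?_
  simp at h₁
  simp [h₁]

theorem appendWord_getElem? (w v : List Sym) :
    appendWord (fun i => w[i]?) v = fun i => (w ++ v)[i]? := by
  funext i
  rw [appendWord, wordLength_getElem?, List.getElem?_append]

/-- The answer of the expand procedure to the identifier `u`, without the final symbol `♯`. -/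
def lookup (W : Web U L) (u : U) : List Sym :=
  (W.adoc u).elim [] fun d => encTriples (W.data d)

theorem expansion_webTape (W : Web U L) (w : List Sym) (u : U) :
    expansion U L (webTape W) (fun i => (w ++ encId u)[i]?) = lookup W u ++ [Sym.sharp] := by
  classical
  -- The definition of `expansion` chooses a document; every admissible choice is the document of
  -- `u`.
  have key (T : Finset (Triple U L)) (u' : U)
      (h : (encId u').map some <:+ tapeWord (fun i => (w ++ encId u)[i]?) ∧
        TapeContains (webTape W) ([Sym.sharp] ++ encId u' ++ encTriples T ++ [Sym.sharp])) :
      ∃ d, W.adoc u = some d ∧ T = W.data d := by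
    obtain ⟨h₁, h₂⟩ := h
    rw [tapeWord_getElem?] at h₁
    obtain rfl : u' = u := by
      refine eq_of_suffix (w := w) ?_
      obtain ⟨v, hv⟩ := h₁
      have hlen := congrArg List.length hv
      simp only [List.length_append, List.length_map] at hlen
      have := congrArg (List.drop v.length) hv
      rw [List.drop_left, ← List.map_drop] at this
      exact ⟨_, by
        rw [Option.some_injective _ |>.list_map this]; exact List.take_append_drop v.length _⟩
    rw [tapeContains_webTape W (by simp)] at h₂
    obtain ⟨n, hn⟩ := h₂
    obtain ⟨u₁, d, h₁, h₂⟩ := exists_of_infix_webPrefix W (x := encId u' ++ encTriples T)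
      (by simp [sharp_notMem_encId, sharp_notMem_encTriples]) (n := n) (by simpa using hn)
    obtain ⟨rfl, rfl⟩ := encId_append_encTriples_inj h₂
    exact ⟨d, h₁, rfl⟩
  rw [expansion]
  split_ifs with h
  · obtain ⟨u', h'⟩ := h.choose_spec
    obtain ⟨d, hd, h''⟩ := key _ u' h'
    rw [h'', lookup, hd, Option.elim_some]
  · cases hd : W.adoc u with
    | none => simp [lookup, hd]
    | some d =>
      refine absurd ⟨W.data d, u, ?_, ?_⟩ h
      · rw [tapeWord_getElem?, List.map_append]
        exact List.suffix_append _ _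
      · exact (tapeContains_webTape W (by simp)).2 ⟨_, infix_webPrefix W hd⟩

theorem sharp_notMem_lookup (W : Web U L) (u : U) : Sym.sharp ∉ lookup W u := by
  rw [lookup]
  cases W.adoc u with
  | none => simp
  | some d => exact sharp_notMem_encTriples _

theorem mem_readWord_lookup (W : Web U L) (u : U) (r : List (U ⊕ L)) :
    r ∈ readWord U L (lookup W u) ↔ ∃ d, W.adoc u = some d ∧ ∃ t ∈ W.data d, tripleRow t = r := by
  rw [lookup]
  cases W.adoc u with
  | none => simp [readWord]
  | some d => simp [readWord_encTriples]

end

end LinkedData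

namespace LinkedData

/-! ## Computability of encodings -/

/-- Finitely many primitive recursive functions are combined by case distinction on the first
argument. -/
theorem primrec₂_of_dom_finite {α β γ : Type} [Primcodable α] [Finite α] [Primcodable β]
    [Primcodable γ] {f : α → β → γ} (h : ∀ a, Primrec (f a)) : Primrec₂ f := by
  obtain ⟨n, ⟨e⟩⟩ := Finite.exists_equiv_fin α
  have h' : Primrec₂ fun (i : Fin n) b => f (e.symm i) b := Primrec.fin_curry₁.2 fun i => h _
  refine (h'.comp ((Primrec.dom_finite e).comp .fst) .snd).of_eq fun x => ?_
  simp

/-- Splitting off the lowest binary digit of the number. -/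
def bitsStep (x : List Bool × ℕ) : List Bool × ℕ :=
  if x.2 = 0 then x else (x.1 ++ [x.2.bodd], x.2.div2)

theorem iterate_bitsStep (k n : ℕ) (l : List Bool) (h : n ≤ k) :
    (bitsStep^[k] (l, n)).1 = l ++ n.bits := by
  induction k generalizing n l with
  | zero => simp [Nat.le_zero.1 h]
  | succ k ih =>
    rw [Function.iterate_succ_apply]
    by_cases hn : n = 0
    · subst hn
      rw [bitsStep, if_pos rfl, ih _ _ (by omega)]
    · have hb : n.bits = n.bodd :: n.div2.bits := by
        conv_lhs => rw [← Nat.bit_bodd_div2 n]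
        refine Nat.bits_append_bit _ _ fun h0 => ?_
        have := Nat.bodd_add_div2 n
        rw [h0] at this
        cases hb : n.bodd <;> simp_all
      rw [bitsStep, if_neg hn, ih, hb]
      · simp
      · have := Nat.div2_val n
        simp only
        omega

theorem primrec_bits : Primrec Nat.bits := by
  have h : Primrec bitsStep :=
    Primrec.ite (Primrec.eq.comp .snd (.const 0)) .id
      ((Primrec.list_concat.comp .fst (Primrec.nat_bodd.comp .snd)).pair
        (Primrec.nat_div2.comp .snd))
  -- `n` halvings exhaust `n`; superfluous ones change nothing.
  have := Primrec.fst.comp (Primrec.nat_iterate (α := ℕ) .id ((Primrec.const []).pair .id)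
    (h.comp .snd).to₂)
  refine this.of_eq fun n => ?_
  simpa using iterate_bitsStep n n [] le_rfl

theorem primrec_encBinary {α : Type} [Denumerable α] :
    Primrec (encBinary : α → List Sym) :=
  Primrec.list_map (primrec_bits.comp .encode) ((Primrec.dom_finite Sym.bit).comp .snd).to₂

section

variable {U L : Type} [Denumerable U] [Denumerable L]

theorem primrec_encId : Primrec (encId : U → List Sym) :=
  Primrec.list_cons.comp (.const _) primrec_encBinary

theorem primrec_encConst : Primrec (encConst : U ⊕ L → List Sym) := by
  refine (Primrec.sumCasesOn .id (primrec_encId.comp .snd).to₂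
    ((Primrec.list_cons.comp (.const Sym.lit) primrec_encBinary).comp .snd).to₂).of_eq fun x => ?_
  cases x <;> rfl

theorem primrec_readSym : Primrec₂ (readSym (U := U) (L := L)) := by
  have hc : Primrec fun st : ℕ × List (U ⊕ L) × List (List (U ⊕ L)) => st.2.1 := .comp .fst .snd
  have hr : Primrec fun st : ℕ × List (U ⊕ L) × List (List (U ⊕ L)) => st.2.2 := .comp .snd .snd
  refine primrec₂_of_dom_finite fun x => ?_
  cases x with
  | bit b =>
    refine Primrec.pair ?_ .snd
    cases b
    · exact Primrec.nat_double.comp .fst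
    · exact Primrec.nat_double_succ.comp .fst
  | ident =>
    exact (Primrec.const 0).pair ((Primrec.list_cons.comp
      (Primrec.sumInl.comp ((Primrec.ofNat U).comp .fst)) hc).pair hr)
  | lit =>
    exact (Primrec.const 0).pair ((Primrec.list_cons.comp
      (Primrec.sumInr.comp ((Primrec.ofNat L).comp .fst)) hc).pair hr)
  | langle => exact (Primrec.const 0).pair ((Primrec.const []).pair (Primrec.list_cons.comp hc hr))
  | _ => exact .id

theorem primrec_readWord : Primrec (readWord U L) :=
  (Primrec.snd.comp .snd).comp (Primrec.list_foldr .id (.const (0, [], []))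
    (primrec_readSym.comp (Primrec.fst.comp .snd) (Primrec.snd.comp .snd)).to₂)

/-! ## A process that looks up all identifiers -/

/-- The contents of documents, in reverse order of their retrieval. -/
abbrev History (U L : Type) : Type := List (List (List (U ⊕ L)))

/-- A state consists of the documents retrieved so far, of the part of a document that is being
read, in reverse order, and of a list of scheduled commands. -/
abbrev ProcState (U L : Type) : Type := History U L × List Sym × List Cmd

/-- Output a word that depends on the retrieved documents and look up the next identifier. -/
def roundCmds (say : History U L → List Sym) (h : History U L) : List Cmd :=
  (say h).map Cmd.output ++ ((encId (Denumerable.ofNat U h.length)).map Cmd.write ++ [Cmd.expand])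

/-- The transition function. -/
def lookupProc (say : History U L → List Sym) :
    ProcState U L × Option Sym → ProcState U L × Cmd
  | ((h, w, c :: q), _) => ((h, w, q), c)
  -- This clause starts the first round: the initial state must have code zero and so carries no
  -- schedule. Later the schedule runs out only in front of an answer that ends with `♯`.
  | ((h, w, []), none) => ((h, w, roundCmds say h), .nop)
  | ((h, w, []), some x) =>
    bif x == .sharp then
      ((readWord U L w.reverse :: h, [], roundCmds say (readWord U L w.reverse :: h)), .advance)
    else ((h, x :: w, []), .advance)

theorem lookupProc_sharp (say : History U L → List Sym) (h : History U L) (w : List Sym) :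
    lookupProc say ((h, w, []), some .sharp) =
      ((readWord U L w.reverse :: h, [], roundCmds say (readWord U L w.reverse :: h)), .advance) :=
  rfl

theorem lookupProc_of_ne (say : History U L → List Sym) (h : History U L) (w : List Sym) {x : Sym}
    (hx : x ≠ .sharp) : lookupProc say ((h, w, []), some x) = ((h, x :: w, []), .advance) := by
  simp only [lookupProc, beq_false_of_ne hx, cond_false]

theorem computable_roundCmds {say : History U L → List Sym} (hs : Computable say) :
    Computable (roundCmds say) := by
  have hmap {f : Sym → Cmd} : Computable fun l : List Sym => l.map f :=
    (Primrec.list_map .id ((Primrec.dom_finite f).comp .snd).to₂).to_comp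
  exact Computable.list_append.comp (hmap.comp hs) (Computable.list_concat.comp (hmap.comp
    (primrec_encId.to_comp.comp ((Computable.ofNat U).comp .list_length))) (.const _))

theorem computable_lookupProc {say : History U L → List Sym} (hs : Computable say) :
    Computable (lookupProc say) := by
  have hr := computable_roundCmds hs
  have hh : Computable fun p : ProcState U L × Option Sym => p.1.1 := .comp .fst .fst
  have hw : Computable fun p : ProcState U L × Option Sym => p.1.2.1 :=
    .comp .fst (.comp .snd .fst)
  have hq : Computable fun p : ProcState U L × Option Sym => p.1.2.2 :=
    .comp .snd (.comp .snd .fst)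
  have h' : Computable fun p : ProcState U L × Option Sym =>
      readWord U L p.1.2.1.reverse :: p.1.1 :=
    Computable.list_cons.comp (primrec_readWord.to_comp.comp (Computable.list_reverse.comp hw)) hh
  have h₁ : Computable₂ fun (p : ProcState U L × Option Sym) (c : Cmd) =>
      ((p.1.1, p.1.2.1, p.1.2.2.tail), c) :=
    ((hh.pair (hw.pair (Primrec.list_tail.to_comp.comp hq))).comp .fst).pair .snd
  have h₂ : Computable fun p : ProcState U L × Option Sym =>
      ((p.1.1, p.1.2.1, roundCmds say p.1.1), Cmd.nop) :=
    (hh.pair (hw.pair (hr.comp hh))).pair (.const _)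
  have h₃ : Computable₂ fun (p : ProcState U L × Option Sym) (x : Sym) =>
      bif x == .sharp then
        ((readWord U L p.1.2.1.reverse :: p.1.1, ([] : List Sym),
          roundCmds say (readWord U L p.1.2.1.reverse :: p.1.1)), Cmd.advance)
      else ((p.1.1, x :: p.1.2.1, []), Cmd.advance) :=
    Computable.cond ((Primrec.dom_finite (· == Sym.sharp)).to_comp.comp .snd)
      (((h'.pair ((Computable.const []).pair (hr.comp h'))).pair (.const _)).comp .fst)
      (((hh.comp .fst).pair ((Computable.list_cons.comp .snd (hw.comp .fst)).pair
        (.const []))).pair (.const _))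
  refine (Computable.option_casesOn (Primrec.list_head?.to_comp.comp hq)
    (Computable.option_casesOn Computable.snd h₂ h₃) h₁).of_eq fun p => ?_
  rcases p with ⟨⟨h, w, _ | ⟨c, q⟩⟩, _ | x⟩ <;> rfl

/-- The documents of a Web that belong to the first identifiers. -/
def history (W : Web U L) : ℕ → History U L
  | 0 => []
  | n + 1 => readWord U L (lookup W (Denumerable.ofNat U n)) :: history W n

theorem length_history (W : Web U L) (n : ℕ) : (history W n).length = n := by
  induction n with
  | zero => rfl
  | succ n ih => simp [history, ih]

/-! ### Rounds of the lookup process -/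

variable (say : History U L → List Sym)

theorem iterate_outputs (web : ℕ → Option Sym) (h : History U L) (w xs : List Sym) (q : List Cmd)
    (io : IOConf) :
    (procStep U L (lookupProc say) web)^[xs.length] ((h, w, xs.map Cmd.output ++ q), io) =
      ((h, w, q), ⟨io.link, io.pos, io.out ++ xs⟩) := by
  induction xs generalizing io with
  | nil => simp
  | cons x xs ih =>
    rw [List.length_cons, Function.iterate_succ_apply]
    refine (ih ⟨io.link, io.pos, io.out ++ [x]⟩).trans ?_
    simp

theorem update_getElem? (v : List Sym) (x : Sym) :
    Function.update (fun i => v[i]?) v.length (some x) = fun i => (v ++ [x])[i]? := by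
  funext i
  by_cases hi : i = v.length
  · subst hi; simp
  · rw [Function.update_of_ne hi]
    rcases lt_or_gt_of_ne hi with hi | hi
    · rw [List.getElem?_append_left hi]
    · rw [List.getElem?_eq_none (by omega), List.getElem?_eq_none (by simp; omega)]

theorem iterate_writes (web : ℕ → Option Sym) (h : History U L) (w xs : List Sym) (q : List Cmd)
    (v o : List Sym) :
    (procStep U L (lookupProc say) web)^[xs.length]
      ((h, w, xs.map Cmd.write ++ q), ⟨fun i => v[i]?, v.length, o⟩) =
      ((h, w, q), ⟨fun i => (v ++ xs)[i]?, (v ++ xs).length, o⟩) := by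
  induction xs generalizing v with
  | nil => simp
  | cons x xs ih =>
    rw [List.length_cons, Function.iterate_succ_apply]
    have : procStep U L (lookupProc say) web
        ((h, w, (x :: xs).map Cmd.write ++ q), ⟨fun i => v[i]?, v.length, o⟩) =
        ((h, w, xs.map Cmd.write ++ q), ⟨fun i => (v ++ [x])[i]?, (v ++ [x]).length, o⟩) := by
      simp [procStep, lookupProc, IOConf.exec, update_getElem?]
    rw [this, ih]
    simp

theorem iterate_read (web : ℕ → Option Sym) (h : History U L) (w a xs b o : List Sym)
    (hx : Sym.sharp ∉ xs) :
    (procStep U L (lookupProc say) web)^[xs.length]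
      ((h, w, []), ⟨fun i => (a ++ (xs ++ b))[i]?, a.length, o⟩) =
      ((h, xs.reverse ++ w, []),
        ⟨fun i => (a ++ (xs ++ b))[i]?, (a ++ xs).length, o⟩) := by
  induction xs generalizing a w with
  | nil => simp
  | cons x xs ih =>
    rw [List.length_cons, Function.iterate_succ_apply]
    rw [List.mem_cons, not_or] at hx
    have : procStep U L (lookupProc say) web
        ((h, w, []), ⟨fun i => (a ++ (x :: xs ++ b))[i]?, a.length, o⟩) =
        ((h, x :: w, []), ⟨fun i => ((a ++ [x]) ++ (xs ++ b))[i]?, (a ++ [x]).length, o⟩) := by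
      simp [procStep, lookupProc_of_ne say h w (Ne.symm hx.1), IOConf.exec]
    rw [this, ih _ _ hx.2]
    simp

/-- The output of the process after it has looked up the first identifiers. -/
def roundOutput (W : Web U L) (k : ℕ) : List Sym :=
  (List.range k).flatMap fun i => say (history W i)

theorem exists_procRun_eq (W : Web U L) (k : ℕ) : ∃ n ≥ k, ∃ v : List Sym,
    procRun U L (lookupProc say) ([], [], []) (webTape W) n =
      ((history W k, [], roundCmds say (history W k)),
        ⟨fun i => v[i]?, v.length, roundOutput say W k⟩) := by
  induction k with
  | zero =>
    refine ⟨1, by omega, [], ?_⟩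
    simp [procRun, procStep, lookupProc, IOConf.exec, history, roundOutput]
  | succ k ih =>
    obtain ⟨n, hn, v, h⟩ := ih
    set u : U := Denumerable.ofNat U k
    obtain ⟨x, hx⟩ : ∃ x, lookup W u = x := ⟨_, rfl⟩
    -- Read from the inside, the summands count outputs, writes, the expansion, the reading of the
    -- answer and of its final `♯`. Writing and reading both advance the head, so it is again at the
    -- end of the word.
    refine ⟨1 + (x.length + (1 + ((encId u).length + ((say (history W k)).length + n)))), by omega,
      (v ++ encId u) ++ (x ++ [Sym.sharp]), ?_⟩
    rw [procRun, Function.iterate_add_apply, Function.iterate_add_apply, Function.iterate_add_apply,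
      Function.iterate_add_apply, Function.iterate_add_apply, ← procRun, h, roundCmds,
      iterate_outputs, length_history, iterate_writes]
    have h₁ : (procStep U L (lookupProc say) (webTape W))^[1]
        ((history W k, [], [Cmd.expand]), ⟨fun i => (v ++ encId u)[i]?, (v ++ encId u).length,
          roundOutput say W k ++ say (history W k)⟩) =
        ((history W k, [], []), ⟨fun i => ((v ++ encId u) ++ (x ++ [Sym.sharp]))[i]?,
          (v ++ encId u).length, roundOutput say W k ++ say (history W k)⟩) := by
      simp only [Function.iterate_one, procStep, lookupProc, IOConf.exec]
      rw [expansion_webTape, appendWord_getElem?, hx]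
    rw [h₁, iterate_read _ _ _ _ _ _ _ _ (hx ▸ sharp_notMem_lookup W u)]
    have h₂ : ((v ++ encId u) ++ (x ++ [Sym.sharp]))[((v ++ encId u) ++ x).length]? =
        some Sym.sharp := by
      rw [← List.append_assoc (v ++ encId u)]
      simp
    have h₃ : history W (k + 1) = readWord U L x :: history W k := by rw [← hx]; rfl
    simp only [Function.iterate_one, procStep, h₂, lookupProc_sharp, IOConf.exec, List.append_nil,
      List.reverse_reverse, h₃]
    simp [roundOutput, List.range_succ, add_assoc]

end

end LinkedData

namespace LinkedData

/-! ## Computable operations on lists -/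

/-- A fold becomes recursion over positions. The criterion is merely computable, so list operations
are needed whose step functions are computable rather than primitive recursive. -/
theorem rec_getElem?_eq_foldl {β γ : Type} (l : List β) (h : γ → β → γ) (s : γ) (n : ℕ) :
    (Nat.rec s (fun i t => (l[i]?).elim t (h t)) n : γ) = (l.take n).foldl h s := by
  induction n with
  | zero => simp
  | succ n ih =>
    rw [List.take_add_one, List.foldl_append, ← ih]
    change (l[n]?).elim _ _ = _
    cases l[n]? <;> rfl

section

variable {α β γ : Type} [Primcodable α] [Primcodable β] [Primcodable γ]

theorem computable_list_foldl {f : α → List β} {g : α → γ} {h : α → γ × β → γ}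
    (hf : Computable f) (hg : Computable g) (hh : Computable₂ h) :
    Computable fun a => (f a).foldl (fun s b => h a (s, b)) (g a) := by
  have hs : Computable₂ fun (a : α) (p : ℕ × γ) =>
      (((f a)[p.1]?).elim p.2 fun b => h a (p.2, b) : γ) := by
    refine (Computable.option_casesOn (o := fun x : α × (ℕ × γ) => (f x.1)[x.2.1]?)
      (Computable.list_getElem?.comp (hf.comp .fst) (Computable.fst.comp .snd))
      (Computable.snd.comp .snd) (g := fun x b => h x.1 (x.2.2, b))
      (hh.comp (Computable.fst.comp .fst)
        (((Computable.snd.comp .snd).comp .fst).pair .snd))).of_eq fun x => ?_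
    dsimp only
    cases (f x.1)[x.2.1]? <;> rfl
  refine (Computable.nat_rec (Computable.list_length.comp hf) hg hs).of_eq fun a => ?_
  exact (rec_getElem?_eq_foldl (f a) (fun s b => h a (s, b)) (g a) _).trans
    (by rw [List.take_length])

theorem computable_list_flatMap {f : α → List β} {g : α → β → List γ}
    (hf : Computable f) (hg : Computable₂ g) : Computable fun a => (f a).flatMap (g a) := by
  have hh : Computable₂ fun (a : α) (p : List γ × β) => p.1 ++ g a p.2 :=
    Computable.list_append.comp (Computable.fst.comp .snd)
      (hg.comp .fst (Computable.snd.comp .snd))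
  refine (computable_list_foldl hf (.const []) hh).of_eq fun a => ?_
  have (l : List β) (s : List γ) : l.foldl (fun s b => s ++ g a b) s = s ++ l.flatMap (g a) := by
    induction l generalizing s with
    | nil => simp
    | cons b l ih => simp [ih]
  simpa using this (f a) []

theorem computable_list_filter {f : α → List β} {g : α → β → Bool}
    (hf : Computable f) (hg : Computable₂ g) : Computable fun a => (f a).filter (g a) := by
  have hh : Computable₂ fun (a : α) (b : β) => bif g a b then [b] else [] :=
    Computable.cond hg (Computable.list_cons.comp .snd (.const [])) (.const [])
  refine (computable_list_flatMap hf hh).of_eq fun a => ?_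
  induction f a with
  | nil => rfl
  | cons b l ih => rw [List.flatMap_cons, ih, List.filter_cons]; cases g a b <;> rfl

theorem computable_list_any {f : α → List β} {g : α → β → Bool}
    (hf : Computable f) (hg : Computable₂ g) : Computable fun a => (f a).any (g a) := by
  have hh : Computable₂ fun (a : α) (p : Bool × β) => p.1 || g a p.2 :=
    Primrec.or.to_comp.comp (Computable.fst.comp .snd) (hg.comp .fst (Computable.snd.comp .snd))
  refine (computable_list_foldl hf (.const false) hh).of_eq fun a => ?_
  have (l : List β) (s : Bool) : l.foldl (fun s b => s || g a b) s = (s || l.any (g a)) := by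
    induction l generalizing s with
    | nil => simp
    | cons b l ih => simp [ih, Bool.or_assoc]
  simpa using this (f a) false

/-- The list is fixed, so no uniformity in `i` is required; it will be the list of patterns of the
query. -/
theorem computable_all_const {ι : Type} (l : List ι) {g : ι → α → Bool}
    (hg : ∀ i ∈ l, Computable (g i)) : Computable fun a => l.all fun i => g i a := by
  induction l with
  | nil => exact .const true
  | cons i l ih =>
    exact Primrec.and.to_comp.comp (hg i (by simp)) (ih fun j hj => hg j (by simp [hj]))

theorem computable_iterate {n : α → ℕ} {g : α → γ} {h : α → γ → γ} (hn : Computable n)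
    (hg : Computable g) (hh : Computable₂ h) : Computable fun a => (h a)^[n a] (g a) := by
  refine (Computable.nat_rec hn hg (h := fun a p => h a p.2)
    (hh.comp .fst (Computable.snd.comp .snd))).of_eq fun a => ?_
  induction n a with
  | zero => rfl
  | succ k ih => rw [Function.iterate_succ_apply', ← ih]

end

/-! ## Evaluation over the retrieved documents -/

section

variable {V U L : Type} [Denumerable U]

/-- The data triple with given components. -/
def rowTriple (r : List (U ⊕ L)) : Triple U L :=
  ((r[0]?.bind Sum.getLeft?).getD (Denumerable.ofNat U 0),
    (r[1]?.bind Sum.getLeft?).getD (Denumerable.ofNat U 0),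
    r[2]?.getD (Sum.inl (Denumerable.ofNat U 0)))

theorem rowTriple_tripleRow (t : Triple U L) : rowTriple (tripleRow t) = t := rfl

variable [Denumerable L]

/-- The identifiers in a data triple that satisfy the criterion. -/
def rowLinks (c : Triple U L → U → Bool) (r : List (U ⊕ L)) : List U :=
  (r.filterMap Sum.getLeft?).filter (c (rowTriple r))

/-- The retrieved document of an identifier. -/
def History.doc (h : History U L) (u : U) : List (List (U ⊕ L)) :=
  -- Histories have the newest document first; reversal aligns positions with indices of
  -- identifiers.
  (h.reverse[Encodable.encode u]?).getD []

/-- Add the identifiers that can be reached in one step. -/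
def followLinks (c : Triple U L → U → Bool) (h : History U L) (R : List U) : List U :=
  R ++ R.flatMap fun u => (h.doc u).flatMap (rowLinks c)

/-- The identifiers that can be reached in a bounded number of steps. -/
def reachedIds (c : Triple U L → U → Bool) (seeds : List U) (h : History U L) : List U :=
  -- The bound need not exhaust the links in `h`; it suffices that it grows with the history.
  (followLinks c h)^[h.length] seeds

/-- The data triples of the documents that are known to be reachable. -/
def reachedRows (c : Triple U L → U → Bool) (seeds : List U) (h : History U L) :
    List (List (U ⊕ L)) :=
  (reachedIds c seeds h).flatMap h.doc

open Classical in
/-- The value of a term if the variables `vs` have the values `xs`. -/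
noncomputable def termValue (vs : List V) (xs : List (U ⊕ L)) : V ⊕ (U ⊕ L) → Option (U ⊕ L)
  | Sum.inl v => xs[vs.idxOf v]?
  | Sum.inr x => some x

/-- The components of a triple pattern if the variables `vs` have the values `xs`. -/
noncomputable def patternRow (vs : List V) (tp : Pattern V U L) (xs : List (U ⊕ L)) :
    List (Option (U ⊕ L)) :=
  [termValue vs xs (Sum.map id Sum.inl tp.1), termValue vs xs (Sum.map id Sum.inl tp.2.1),
    termValue vs xs tp.2.2]

open Classical in
/-- The values `xs` of the variables `vs` give a solution over the known data triples. -/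
noncomputable def isKnownSolution (B : BQP V U L) (vs : List V) (c : Triple U L → U → Bool)
    (seeds : List U) (h : History U L) (xs : List (U ⊕ L)) : Bool :=
  decide (xs.length = vs.length) &&
    B.toList.all fun tp => (reachedRows c seeds h).any fun r =>
      decide (r.map some = patternRow vs tp xs)

/-- The solutions with a code below the number of retrieved documents that have not been found
before the retrieval of the last document. -/
noncomputable def newSolutions (B : BQP V U L) (vs : List V) (c : Triple U L → U → Bool)
    (seeds : List U) (h : History U L) : List (List (U ⊕ L)) :=
  -- `decode₂` answers on exact codes only, so distinct `j` give distinct candidates. The tail of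
  -- `h` is the history one lookup earlier.
  (List.range h.length).flatMap fun j => (Encodable.decode₂ (List (U ⊕ L)) j).toList.filter
    fun xs => isKnownSolution B vs c seeds h xs &&
      !(decide (j < h.tail.length) && isKnownSolution B vs c seeds h.tail xs)

open Classical in
/-- The encoding of the valuation that gives the values `xs` to the variables `vs`. -/
noncomputable def encSolution [Denumerable V] (vs : List V) (xs : List (U ⊕ L)) : List Sym :=
  encList (vs.map fun v => encVar v ++ [Sym.arrow] ++ (xs[vs.idxOf v]?).elim [] encConst)

/-! ### Computability of the evaluation -/

theorem primrec_getLeft? {α β : Type} [Primcodable α] [Primcodable β] :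
    Primrec (Sum.getLeft? : α ⊕ β → Option α) := by
  refine (Primrec.sumCasesOn .id (Primrec.option_some.comp .snd).to₂
    (Primrec.const none).to₂).of_eq fun x => ?_
  cases x <;> rfl

theorem primrec_rowTriple : Primrec (rowTriple (U := U) (L := L)) := by
  have hget (i : ℕ) : Primrec fun r : List (U ⊕ L) => r[i]? :=
    Primrec.list_getElem?.comp .id (.const i)
  have hleft (i : ℕ) : Primrec fun r : List (U ⊕ L) =>
      (r[i]?.bind Sum.getLeft?).getD (Denumerable.ofNat U 0) :=
    Primrec.option_getD.comp (Primrec.option_bind (hget i) (primrec_getLeft?.comp .snd).to₂)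
      (.const _)
  exact (hleft 0).pair ((hleft 1).pair (Primrec.option_getD.comp (hget 2) (.const _)))

variable {c : Triple U L → U → Bool}

theorem computable_rowLinks (hc : Computable fun x : Triple U L × U => c x.1 x.2) :
     Computable (rowLinks c) := by
  refine computable_list_filter
    (Primrec.listFilterMap .id (primrec_getLeft?.comp .snd).to₂).to_comp ?_
  exact hc.comp ((primrec_rowTriple.to_comp.comp .fst).pair .snd)

theorem primrec_doc : Primrec₂ (History.doc (U := U) (L := L)) :=
  Primrec.option_getD.comp (Primrec.list_getElem?.comp (Primrec.list_reverse.comp .fst)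
    (Primrec.encode.comp .snd)) (.const [])

theorem computable_followLinks (hc : Computable fun x : Triple U L × U => c x.1 x.2) :
     Computable₂ (followLinks c) := by
  refine Computable.list_append.comp .snd (computable_list_flatMap .snd ?_)
  refine computable_list_flatMap (primrec_doc.to_comp.comp (Computable.fst.comp .fst) .snd) ?_
  exact (computable_rowLinks hc).comp .snd

theorem computable_reachedRows (hc : Computable fun x : Triple U L × U => c x.1 x.2)
    (seeds : List U) : Computable (reachedRows c seeds) := by
  refine computable_list_flatMap ?_ primrec_doc.to_comp
  exact computable_iterate .list_length (.const _) (computable_followLinks hc)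

theorem primrec_termValue (vs : List V) (t : V ⊕ (U ⊕ L)) :
    Primrec fun xs : List (U ⊕ L) => termValue vs xs t := by
  cases t with
  | inl v => exact Primrec.list_getElem?.comp .id (.const _)
  | inr x => exact .const _

theorem primrec_patternRow (vs : List V) (tp : Pattern V U L) :
    Primrec (patternRow vs tp) :=
  Primrec.list_cons.comp (primrec_termValue vs _) (Primrec.list_cons.comp (primrec_termValue vs _)
    (Primrec.list_cons.comp (primrec_termValue vs _) (.const [])))

theorem computable_isKnownSolution (hc : Computable fun x : Triple U L × U => c x.1 x.2)
    (B : BQP V U L) (vs : List V) (seeds : List U) :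
    Computable₂ (isKnownSolution B vs c seeds) := by
  classical
  refine Primrec.and.to_comp.comp ?_ (computable_all_const _ fun tp _ => ?_)
  · have h₁ : Primrec fun x : History U L × List (U ⊕ L) => x.2.length :=
      Primrec.list_length.comp .snd
    exact (Primrec₂.comp (f := fun m n : ℕ => decide (m = n)) Primrec.eq.decide h₁
      (.const vs.length)).to_comp
  · refine computable_list_any ((computable_reachedRows hc seeds).comp .fst) ?_
    have h₁ : Primrec fun x : (History U L × List (U ⊕ L)) × List (U ⊕ L) => x.2.map some :=
      Primrec.list_map .snd (Primrec.option_some.comp .snd).to₂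
    have h₂ : Primrec fun x : (History U L × List (U ⊕ L)) × List (U ⊕ L) =>
        patternRow vs tp x.1.2 := (primrec_patternRow vs tp).comp (Primrec.snd.comp .fst)
    exact (Primrec₂.comp (f := fun r s : List (Option (U ⊕ L)) => decide (r = s))
      Primrec.eq.decide h₁ h₂).to_comp

theorem computable_newSolutions (hc : Computable fun x : Triple U L × U => c x.1 x.2)
    (B : BQP V U L) (vs : List V) (seeds : List U) :
    Computable (newSolutions B vs c seeds) := by
  have hk := computable_isKnownSolution hc B vs seeds
  refine computable_list_flatMap (Primrec.list_range.to_comp.comp .list_length) ?_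
  refine computable_list_filter
    ((Primrec.optionToList.comp Primrec.decode₂).to_comp.comp .snd) ?_
  have htail : Primrec fun x : (History U L × ℕ) × List (U ⊕ L) => x.1.1.tail :=
    Primrec.list_tail.comp (Primrec.fst.comp .fst)
  refine Primrec.and.to_comp.comp (hk.comp (Computable.fst.comp .fst) .snd)
    (Primrec.not.to_comp.comp (Primrec.and.to_comp.comp ?_ (hk.comp htail.to_comp .snd)))
  exact (Primrec.nat_lt.decide.comp (Primrec.snd.comp .fst)
    (Primrec.list_length.comp htail)).to_comp

theorem primrec_intercalate {α ι : Type} [Primcodable α] (s : List Sym) {g : ι → α → List Sym}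
    (hg : ∀ i, Primrec (g i)) (l : List ι) :
    Primrec fun a => s.intercalate (l.map fun i => g i a) := by
  induction l with
  | nil => exact .const _
  | cons i l ih =>
    cases l with
    | nil => simpa using hg i
    | cons j l =>
      simp only [List.map_cons, List.intercalate_cons_cons] at ih ⊢
      exact Primrec.list_append.comp (Primrec.list_append.comp (hg i) (.const _)) ih

theorem primrec_encSolution [Denumerable V] (vs : List V) :
    Primrec (encSolution (U := U) (L := L) vs) := by
  classical
  have hx (v : V) : Primrec fun xs : List (U ⊕ L) => (xs[vs.idxOf v]?).elim [] encConst := by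
    refine (Primrec.option_casesOn (o := fun xs : List (U ⊕ L) => xs[vs.idxOf v]?)
      (Primrec.list_getElem?.comp .id (.const _)) (.const [])
      (primrec_encConst.comp .snd).to₂).of_eq fun xs => ?_
    cases xs[vs.idxOf v]? <;> rfl
  refine Primrec.list_cons.comp (.const _) (Primrec.list_append.comp
    (primrec_intercalate _ (fun v => Primrec.list_append.comp (.const _) ?_) vs) (.const _))
  convert hx v

/-- The word that is output after the retrieval of a document. -/
noncomputable def newOutput [Denumerable V] (B : BQP V U L) (vs : List V)
    (c : Triple U L → U → Bool) (seeds : List U) (h : History U L) : List Sym :=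
  (newSolutions B vs c seeds h).flatMap (encSolution vs)

theorem computable_newOutput [Denumerable V]
    (hc : Computable fun x : Triple U L × U => c x.1 x.2) (B : BQP V U L) (vs : List V)
    (seeds : List U) : Computable (newOutput B vs c seeds) :=
  computable_list_flatMap (computable_newSolutions hc B vs seeds)
    ((primrec_encSolution vs).to_comp.comp .snd)

end

end LinkedData

namespace LinkedData

/-! ## Prefixes of encodings of sets of valuations -/

section

variable {V U L : Type} [Encodable V] [Encodable U] [Encodable L]

theorem IsPrefixOfEncoding.of_prefix {Ω : Set (Valuation V U L)} {p p' : List Sym}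
    (h : IsPrefixOfEncoding Ω p') (hp : p <+: p') : IsPrefixOfEncoding Ω p := by
  rcases h with ⟨w, hw, h⟩ | ⟨e, he, hr, n, h⟩
  · exact .inl ⟨w, hw, hp.trans h⟩
  · exact .inr ⟨e, he, hr, n, hp.trans h⟩

/-- First the list is used up, then an enumeration of the rest of `s`, which is still infinite. -/
theorem exists_enumeration_extending {α : Type} {s : Set α} (hs : s.Countable) (hi : s.Infinite)
    {l : List α} (hl : l.Nodup) (h : ∀ x ∈ l, x ∈ s) :
    ∃ e : ℕ → α, Function.Injective e ∧ Set.range e = s ∧ (List.range l.length).map e = l := by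
  classical
  have hr : (s \ {x | x ∈ l}).Infinite := hi.sdiff l.finite_toSet
  have : Infinite ↥(s \ {x | x ∈ l}) := hr.to_subtype
  have : Countable ↥(s \ {x | x ∈ l}) := (hs.mono Set.sdiff_subset).to_subtype
  obtain ⟨d⟩ := nonempty_denumerable ↥(s \ {x | x ∈ l})
  let f : ℕ ≃ ↥(s \ {x | x ∈ l}) := (Denumerable.eqv _).symm
  have hf (n : ℕ) : (f n : α) ∉ l := (f n).2.2
  refine ⟨fun n => if h : n < l.length then l[n] else f (n - l.length), fun m n hmn => ?_, ?_, ?_⟩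
  · dsimp only at hmn
    split_ifs at hmn with h₁ h₂ h₂
    · exact hl.getElem_inj_iff.1 hmn
    · exact absurd (hmn ▸ List.getElem_mem h₁) (hf _)
    · exact absurd (hmn ▸ List.getElem_mem h₂) (hf _)
    · have := f.injective (Subtype.ext hmn)
      omega
  · ext x
    constructor
    · rintro ⟨n, rfl⟩
      dsimp only
      split_ifs with h₁
      · exact h _ (List.getElem_mem h₁)
      · exact (f _).2.1
    · intro hx
      by_cases hxl : x ∈ l
      · obtain ⟨n, hn, rfl⟩ := List.getElem_of_mem hxl
        exact ⟨n, by simp [hn]⟩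
      · exact ⟨l.length + f.symm ⟨x, hx, hxl⟩, by simp⟩
  · refine List.ext_getElem (by simp) fun n h₁ h₂ => ?_
    simp [h₂]

theorem isPrefixOfEncoding_flatMap {Ω : Set (Valuation V U L)} (hΩ : Ω.Countable)
    {l : List (Valuation V U L)} (hl : l.Nodup) (h : ∀ μ ∈ l, μ ∈ Ω) :
    IsPrefixOfEncoding Ω (l.flatMap encValuation) := by
  classical
  rcases Ω.finite_or_infinite with hf | hi
  · refine .inl ⟨_, ⟨l ++ (hf.toFinset \ l.toFinset).toList, ?_, fun μ => ?_, rfl⟩, ?_⟩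
    · refine hl.append (Finset.nodup_toList _) fun μ h₁ h₂ => ?_
      simp at h₂
      exact h₂.2 h₁
    · by_cases hμ : μ ∈ l
      · simp [hμ, h μ hμ]
      · simp [hμ]
    · rw [List.flatMap_append]
      exact List.prefix_append _ _
  · obtain ⟨e, he, hr, hel⟩ := exists_enumeration_extending hΩ hi hl h
    exact .inr ⟨e, he, hr, l.length, by rw [hel]⟩

end

/-! ## Valuations given by lists of values -/

section

variable {V U L : Type}

theorem Valuation.ext_toFun {μ ν : Valuation V U L} (h : μ.toFun = ν.toFun) : μ = ν := by
  cases μ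
  cases ν
  cases h
  rfl

open Classical in
/-- The valuation that gives the values `xs` to the variables `vs`. -/
noncomputable def valuationOf (vs : List V) (xs : List (U ⊕ L)) : Valuation V U L where
  -- Variables outside `vs` get the index `vs.length`; the truncation leaves them without value even
  -- if `xs` is too long.
  toFun v := (xs.take vs.length)[vs.idxOf v]?
  finite_dom := by
    refine vs.finite_toSet.subset fun v hv => ?_
    simp only [Set.mem_ofPred_eq, isSome_getElem?, List.length_take, lt_inf_iff] at hv
    exact List.idxOf_lt_length_iff.1 hv.1

variable {vs : List V} {xs : List (U ⊕ L)}

open Classical in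
theorem valuationOf_toFun (h : xs.length = vs.length) (v : V) :
    (valuationOf vs xs).toFun v = xs[vs.idxOf v]? := by
  change (xs.take vs.length)[vs.idxOf v]? = _
  rw [← h, List.take_length]

theorem valuationOf_dom (h : xs.length = vs.length) : (valuationOf vs xs).dom = {v | v ∈ vs} := by
  ext v
  simp [Valuation.dom, valuationOf_toFun h, h, List.idxOf_lt_length_iff]

theorem valuationOf_injective (hvs : vs.Nodup) {ys : List (U ⊕ L)} (hx : xs.length = vs.length)
    (hy : ys.length = vs.length) (h : valuationOf vs xs = valuationOf vs ys) : xs = ys := by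
  classical
  refine List.ext_getElem (hx.trans hy.symm) fun i h₁ h₂ => ?_
  have hi : vs.idxOf vs[i] = i := hvs.idxOf_getElem i (hx ▸ h₁)
  have := congrArg (fun μ => μ.toFun vs[i]) h
  rw [valuationOf_toFun hx, valuationOf_toFun hy] at this
  have h₃ : xs[vs.idxOf vs[i]]? = ys[vs.idxOf vs[i]]? := by convert this
  simpa only [hi, List.getElem?_eq_getElem h₁, List.getElem?_eq_getElem h₂, Option.some.injEq]
    using h₃

theorem exists_valuationOf_eq [Nonempty U] {μ : Valuation V U L} (h : μ.dom = {v | v ∈ vs}) :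
    ∃ xs, xs.length = vs.length ∧ valuationOf vs xs = μ := by
  classical
  obtain ⟨u⟩ := ‹Nonempty U›
  -- The default `u` is never taken, as `μ` is defined on all of `vs`.
  have hl : (vs.map fun v => (μ.toFun v).getD (Sum.inl u)).length = vs.length := by simp
  refine ⟨_, hl, Valuation.ext_toFun (funext fun v => ?_)⟩
  have hv : (μ.toFun v).isSome ↔ v ∈ vs := Set.ext_iff.1 h v
  rw [valuationOf_toFun hl]
  by_cases hm : v ∈ vs
  · have hi := List.idxOf_lt_length_iff.2 hm
    rw [List.getElem?_map, List.getElem?_eq_getElem hi, List.getElem_idxOf hi]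
    obtain ⟨x, hx⟩ := Option.isSome_iff_exists.1 (hv.2 hm)
    simp [hx]
  · rw [List.getElem?_eq_none (by simp [List.idxOf_eq_length hm])]
    cases hx : μ.toFun v with
    | none => rfl
    | some x => exact absurd (hv.1 (by simp [hx])) hm

/-- A variable without value stays a variable on the left and gives `none` on the right, so both
sides fail. -/
theorem applyTerm_valuationOf (h : xs.length = vs.length) (t : V ⊕ (U ⊕ L)) (x : U ⊕ L) :
    (valuationOf vs xs).applyTerm t = Sum.inr x ↔ termValue vs xs t = some x := by
  classical
  cases t with
  | inl v =>
    rw [Valuation.applyTerm, valuationOf_toFun h]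
    change _ ↔ xs[vs.idxOf v]? = some x
    cases xs[vs.idxOf v]? <;> simp
  | inr y => simp [Valuation.applyTerm, termValue]

theorem applyPattern_valuationOf (h : xs.length = vs.length) (tp : Pattern V U L)
    (t : Triple U L) : (valuationOf vs xs).applyPattern tp = Triple.toTerms V t ↔
      (tripleRow t).map some = patternRow vs tp xs := by
  simp only [Valuation.applyPattern, Triple.toTerms, Prod.mk.injEq, applyTerm_valuationOf h,
    tripleRow, patternRow, List.map_cons, List.map_nil, List.cons.injEq, and_true]
  simp only [eq_comm]

theorem encValuation_valuationOf [Denumerable V] [Denumerable U] [Denumerable L] {S : Finset V}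
    {xs : List (U ⊕ L)} (h : xs.length = (S.sort (Encodable.encode' V ⁻¹'o (· ≤ ·))).length) :
    encValuation (valuationOf (S.sort (Encodable.encode' V ⁻¹'o (· ≤ ·))) xs) =
      encSolution (S.sort (Encodable.encode' V ⁻¹'o (· ≤ ·))) xs := by
  have hS : (valuationOf (S.sort (Encodable.encode' V ⁻¹'o (· ≤ ·))) xs).finite_dom.toFinset =
      S := by
    ext v
    rw [Set.Finite.mem_toFinset]
    exact (Set.ext_iff.1 (valuationOf_dom h) v).trans (Finset.mem_sort _)
  rw [encValuation, encSolution, hS]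
  simp only [valuationOf_toFun h]

end

/-! ## Reachability in the retrieved documents -/

section

variable {V U L : Type} [Denumerable U]

theorem mem_rowLinks {c : Triple U L → U → Bool} {t : Triple U L} {u : U} :
    u ∈ rowLinks c (tripleRow t) ↔ OccursIn u t ∧ c t u = true := by
  rw [rowLinks, List.mem_filter, rowTriple_tripleRow]
  refine and_congr_left fun _ => ?_
  obtain ⟨s, p, o⟩ := t
  cases o <;> simp [tripleRow, OccursIn, eq_comm]

theorem isKnownSolution_iff {B : BQP V U L} {vs : List V} {c : Triple U L → U → Bool}
    {S : List U} {h : History U L} {xs : List (U ⊕ L)} :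
    isKnownSolution B vs c S h xs = true ↔ xs.length = vs.length ∧
      ∀ tp ∈ B, ∃ r ∈ reachedRows c S h, r.map some = patternRow vs tp xs := by
  simp [isKnownSolution]

variable [Denumerable L] (W : Web U L)

theorem reverse_history (n : ℕ) : (history W n).reverse =
    (List.range n).map fun i => readWord U L (lookup W (Denumerable.ofNat U i)) := by
  induction n with
  | zero => rfl
  | succ n ih => rw [history, List.reverse_cons, ih, List.range_succ, List.map_append]; rfl

theorem tail_history (n : ℕ) : (history W n).tail = history W (n - 1) := by
  cases n <;> rfl

variable {W}

theorem mem_doc_history {n : ℕ} {u : U} {r : List (U ⊕ L)} : r ∈ (history W n).doc u ↔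
    Encodable.encode u < n ∧ ∃ d, W.adoc u = some d ∧ ∃ t ∈ W.data d, tripleRow t = r := by
  rw [← mem_readWord_lookup, History.doc, reverse_history]
  by_cases h : Encodable.encode u < n <;> simp [h]

variable {c : Triple U L → U → Bool} {S : List U}

theorem mem_followLinks {n : ℕ} {R : List U} {u : U} : u ∈ followLinks c (history W n) R ↔
    u ∈ R ∨ ∃ u' ∈ R, Encodable.encode u' < n ∧ ∃ d, W.adoc u' = some d ∧ ∃ t ∈ W.data d,
      OccursIn u t ∧ c t u = true := by
  simp only [followLinks, List.mem_append, List.mem_flatMap, mem_doc_history]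
  refine or_congr_right (exists_congr fun u' => and_congr_right fun _ => ⟨?_, ?_⟩)
  · rintro ⟨_, ⟨hn, d, hd, t, ht, rfl⟩, hu⟩
    exact ⟨hn, d, hd, t, ht, mem_rowLinks.1 hu⟩
  · rintro ⟨hn, d, hd, t, ht, hu⟩
    exact ⟨_, ⟨hn, d, hd, t, ht, rfl⟩, mem_rowLinks.2 hu⟩

theorem iterate_followLinks_subset {m n j k : ℕ} (hmn : m ≤ n) (hjk : j ≤ k) :
    (followLinks c (history W m))^[j] S ⊆ (followLinks c (history W n))^[k] S := by
  induction k, hjk using Nat.le_induction with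
  | base =>
    induction j with
    | zero => exact List.Subset.refl _
    | succ j ih =>
      intro u hu
      rw [Function.iterate_succ_apply', mem_followLinks] at hu ⊢
      rcases hu with hu | ⟨u', hu', hm, hu⟩
      · exact .inl (ih hu)
      · exact .inr ⟨u', ih hu', hm.trans_le hmn, hu⟩
  | succ k _ ih =>
    intro u hu
    rw [Function.iterate_succ_apply', mem_followLinks]
    exact .inl (ih hu)

theorem reachedIds_subset {m n : ℕ} (h : m ≤ n) :
    reachedIds c S (history W m) ⊆ reachedIds c S (history W n) := by
  rw [reachedIds, reachedIds, length_history, length_history]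
  exact iterate_followLinks_subset h h

theorem reachable_of_mem_reachedIds {S : Finset U} {n : ℕ} {u : U}
    (hu : u ∈ reachedIds c S.toList (history W n)) {d : W.D} (hd : W.adoc u = some d) :
    Reachable W S c d := by
  rw [reachedIds] at hu
  -- The number of rounds is detached from the history, so that induction can run on it alone.
  generalize (history W n).length = k at hu
  induction k generalizing u d with
  | zero => exact .seed u d (Finset.mem_toList.1 hu) hd
  | succ k ih =>
    rw [Function.iterate_succ_apply', mem_followLinks] at hu
    rcases hu with hu | ⟨u', hu', -, d', hd', t, ht, htu, hc⟩
    · exact ih hd hu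
    · exact .link d' d t u (ih hd' hu') ht htu hd hc

theorem Reachable.exists_mem_reachedIds {S : Finset U} {d : W.D} (h : Reachable W S c d) :
    ∃ u n, W.adoc u = some d ∧ u ∈ reachedIds c S.toList (history W n) := by
  induction h with
  | seed u d hu hd => exact ⟨u, 0, hd, Finset.mem_toList.2 hu⟩
  | link d' d t u _ ht htu hd hc ih =>
    obtain ⟨u', n, hd', hu'⟩ := ih
    refine ⟨u, max n (Encodable.encode u' + 1) + 1, hd, ?_⟩
    rw [reachedIds, length_history]
    refine iterate_followLinks_subset (m := max n (Encodable.encode u' + 1)) (Nat.le_succ _)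
      le_rfl ?_
    rw [Function.iterate_succ_apply', mem_followLinks]
    have := reachedIds_subset (c := c) (S := S.toList) (W := W)
      (le_max_left n (Encodable.encode u' + 1)) hu'
    rw [reachedIds, length_history] at this
    exact .inr ⟨u', this, by simp, d', hd', t, ht, htu, hc⟩

theorem reachedRows_subset {m n : ℕ} (h : m ≤ n) :
    reachedRows c S (history W m) ⊆ reachedRows c S (history W n) := by
  intro r hr
  simp only [reachedRows, List.mem_flatMap, mem_doc_history] at hr ⊢
  obtain ⟨u, hu, hm, hr⟩ := hr
  exact ⟨u, reachedIds_subset h hu, hm.trans_le h, hr⟩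

theorem exists_mem_reachedRows {S : Finset U} {r : List (U ⊕ L)} :
    (∃ n, r ∈ reachedRows c S.toList (history W n)) ↔
      ∃ t ∈ (W.induced {d | Reachable W S c d}).allData, tripleRow t = r := by
  simp only [reachedRows, List.mem_flatMap, mem_doc_history]
  constructor
  · rintro ⟨n, u, hu, -, d, hd, t, ht, rfl⟩
    exact ⟨t, ⟨⟨d, reachable_of_mem_reachedIds hu hd⟩, ht⟩, rfl⟩
  · rintro ⟨t, ⟨⟨d, h⟩, ht⟩, rfl⟩
    obtain ⟨u, n, hd, hu⟩ := Reachable.exists_mem_reachedIds h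
    exact ⟨max n (Encodable.encode u + 1), u, reachedIds_subset (le_max_left _ _) hu, by simp, d,
      hd, t, ht, rfl⟩

/-! ## The solutions that are found -/

variable {B : BQP V U L} {vs : List V}

theorem isKnownSolution_mono {m n : ℕ} (h : m ≤ n) {xs : List (U ⊕ L)}
    (hm : isKnownSolution B vs c S (history W m) xs = true) :
    isKnownSolution B vs c S (history W n) xs = true := by
  rw [isKnownSolution_iff] at hm ⊢
  refine ⟨hm.1, fun tp htp => ?_⟩
  obtain ⟨r, hr, hx⟩ := hm.2 tp htp
  exact ⟨r, reachedRows_subset h hr, hx⟩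

theorem exists_isKnownSolution {S : Finset U} {xs : List (U ⊕ L)} :
    (∃ n, isKnownSolution B vs c S.toList (history W n) xs = true) ↔
      xs.length = vs.length ∧ ∀ tp ∈ B, ∃ t ∈ (W.induced {d | Reachable W S c d}).allData,
        (tripleRow t).map some = patternRow vs tp xs := by
  simp only [isKnownSolution_iff]
  constructor
  · rintro ⟨n, hl, hn⟩
    refine ⟨hl, fun tp htp => ?_⟩
    obtain ⟨r, hr, hx⟩ := hn tp htp
    obtain ⟨t, ht, rfl⟩ := exists_mem_reachedRows.1 ⟨n, hr⟩
    exact ⟨t, ht, hx⟩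
  · rintro ⟨hl, h⟩
    have (tp : Pattern V U L) : ∃ n, tp ∈ B → ∃ r ∈ reachedRows c S.toList (history W n),
        r.map some = patternRow vs tp xs := by
      by_cases htp : tp ∈ B
      · obtain ⟨t, ht, hx⟩ := h tp htp
        obtain ⟨n, hn⟩ := exists_mem_reachedRows.2 ⟨t, ht, rfl⟩
        exact ⟨n, fun _ => ⟨_, hn, hx⟩⟩
      · exact ⟨0, fun h => absurd h htp⟩
    choose f hf using this
    -- Each of the finitely many patterns is matched at some stage; the latest stage serves for all.
    refine ⟨B.sup f, hl, fun tp htp => ?_⟩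
    obtain ⟨r, hr, hx⟩ := hf tp htp
    exact ⟨r, reachedRows_subset (Finset.le_sup htp) hr, hx⟩

/-- A monotone condition holds at `n` and fails at `n - 1`, so each `xs` is new at one stage at
most. For `n = 0` nothing qualifies. -/
theorem mem_newSolutions {n : ℕ} {xs : List (U ⊕ L)} :
    xs ∈ newSolutions B vs c S (history W n) ↔
      (Encodable.encode xs < n ∧ isKnownSolution B vs c S (history W n) xs = true) ∧
        ¬(Encodable.encode xs < n - 1 ∧
          isKnownSolution B vs c S (history W (n - 1)) xs = true) := by
  simp only [newSolutions, List.mem_flatMap, List.mem_range, length_history, tail_history,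
    List.mem_filter, Option.mem_toList, Encodable.decode₂_eq_some,
    Bool.and_eq_true, Bool.not_eq_true', ← Bool.not_eq_true, decide_eq_true_eq]
  constructor
  · rintro ⟨_, hn, rfl, h⟩
    exact ⟨⟨hn, h.1⟩, h.2⟩
  · rintro ⟨⟨hn, h₁⟩, h₂⟩
    exact ⟨_, hn, rfl, h₁, h₂⟩

theorem nodup_newSolutions (h : History U L) : (newSolutions B vs c S h).Nodup := by
  refine List.nodup_flatMap.2 ⟨fun j _ => List.Nodup.filter _ ?_, ?_⟩
  · cases Encodable.decode₂ (List (U ⊕ L)) j <;> simp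
  · refine List.nodup_range.imp fun {i j} hij xs hi hj => hij ?_
    simp only [List.mem_filter, Option.mem_toList,
      Encodable.decode₂_eq_some] at hi hj
    exact hi.1.symm.trans hj.1

theorem nodup_flatMap_newSolutions (k : ℕ) :
    ((List.range k).flatMap fun i => newSolutions B vs c S (history W i)).Nodup := by
  refine List.nodup_flatMap.2 ⟨fun _ _ => nodup_newSolutions _, ?_⟩
  refine List.pairwise_lt_range.imp fun {i j} hij xs hi hj => ?_
  rw [mem_newSolutions] at hi hj
  exact hj.2 ⟨by omega, isKnownSolution_mono (by omega) hi.1.2⟩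

theorem exists_mem_newSolutions {xs : List (U ⊕ L)} :
    (∃ n, xs ∈ newSolutions B vs c S (history W n)) ↔
      ∃ n, isKnownSolution B vs c S (history W n) xs = true := by
  classical
  refine ⟨fun ⟨n, h⟩ => ⟨n, (mem_newSolutions.1 h).1.2⟩, fun ⟨n, h⟩ => ?_⟩
  have hex : ∃ n, Encodable.encode xs < n ∧ isKnownSolution B vs c S (history W n) xs = true :=
    ⟨max n (Encodable.encode xs + 1), by simp, isKnownSolution_mono (le_max_left _ _) h⟩
  have hpos : Nat.find hex ≠ 0 := fun h0 => by
    have := (Nat.find_spec hex).1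
    omega
  exact ⟨Nat.find hex, mem_newSolutions.2 ⟨Nat.find_spec hex, Nat.find_min hex (by omega)⟩⟩

end

/-! ## Eventual computability -/

section

variable {V U L : Type}

theorem BQP.finite_vars (B : BQP V U L) : (BQP.vars B).Finite := by
  refine (B.finite_toSet.biUnion (t := fun tp =>
    {v | tp.1 = Sum.inl v} ∪ {v | tp.2.1 = Sum.inl v} ∪ {v | tp.2.2 = Sum.inl v})
    fun tp _ => ?_).subset ?_
  · refine (Set.Finite.union ?_ ?_).union ?_ <;>
      exact Set.Subsingleton.finite fun v hv w hw => Sum.inl_injective (hv.symm.trans hw)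
  · rintro v ⟨tp, htp, h⟩
    simp only [Set.mem_iUnion]
    exact ⟨tp, htp, by simpa [or_assoc] using h⟩

theorem roundOutput_newOutput [Denumerable V] [Denumerable U] [Denumerable L] {W : Web U L}
    {B : BQP V U L} {vs : List V} {c : Triple U L → U → Bool} {S : List U} (k : ℕ) :
    roundOutput (newOutput B vs c S) W k =
      ((List.range k).flatMap fun i => newSolutions B vs c S (history W i)).flatMap
        (encSolution vs) := by
  rw [roundOutput, List.flatMap_assoc]
  rfl

variable [Denumerable V] [Denumerable U] [Denumerable L]

/-- The variables of a query in increasing order. -/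
noncomputable def CLDQuery.varList (q : CLDQuery V U L) : List V :=
  q.bqp.finite_vars.toFinset.sort (Encodable.encode' V ⁻¹'o (· ≤ ·))

theorem CLDQuery.mem_varList (q : CLDQuery V U L) : {v | v ∈ q.varList} = BQP.vars q.bqp := by
  ext v
  simp [CLDQuery.varList]

theorem CLDQuery.valuationOf_mem_eval (q : CLDQuery V U L) (W : Web U L) {xs : List (U ⊕ L)}
    (hxs : xs.length = q.varList.length) : valuationOf q.varList xs ∈ q.eval W ↔
      ∃ n, xs ∈ newSolutions q.bqp q.varList (fun t u => q.criterion.toFun t u q.bqp)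
        q.seeds.toList (history W n) := by
  rw [exists_mem_newSolutions, exists_isKnownSolution]
  change _ ∧ _ ↔ _
  simp only [applyPattern_valuationOf hxs, valuationOf_dom hxs, CLDQuery.mem_varList, hxs, true_and]
  rfl

theorem CLDQuery.computable_criterion (q : CLDQuery V U L) :
    Computable fun x : Triple U L × U => q.criterion.toFun x.1 x.2 q.bqp := by
  have h₁ : Computable fun x : Triple U L × U => x.1 := .fst
  have h₂ : Computable fun x : Triple U L × U => x.2 := .snd
  have h₃ : Computable fun _ : Triple U L × U => q.bqp := .const _
  have h₄ := h₂.pair h₃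
  have h₅ := h₁.pair h₄
  exact Computable.comp (f := fun x : Triple U L × U × BQP V U L =>
    q.criterion.toFun x.1 x.2.1 x.2.2)
    (g := fun x : Triple U L × U => (x.1, x.2, q.bqp)) q.criterion.computable h₅

theorem CLDQuery.eventuallyComputable (q : CLDQuery V U L) : EventuallyComputable q.eval := by
  have hs := computable_newOutput (c := fun t u => q.criterion.toFun t u q.bqp)
    q.computable_criterion q.bqp q.varList q.seeds.toList
  have h₀ : Encodable.encode (([], [], []) : ProcState U L) = 0 := by
    simp [Nat.pair]
  obtain ⟨M, hM⟩ := exists_machine_of_computable (computable_lookupProc hs) _ h₀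
  refine ⟨M, fun W => ?_⟩
  let sols (k : ℕ) : List (List (U ⊕ L)) := (List.range k).flatMap fun i =>
    newSolutions q.bqp q.varList (fun t u => q.criterion.toFun t u q.bqp) q.seeds.toList
      (history W i)
  have hlen {k : ℕ} {xs : List (U ⊕ L)} (h : xs ∈ sols k) : xs.length = q.varList.length := by
    obtain ⟨i, -, hi⟩ := List.mem_flatMap.1 h
    exact (isKnownSolution_iff.1 (mem_newSolutions.1 hi).1.2).1
  have hout (k : ℕ) : ∃ n ≥ k,
      (M.run [] W n).output = (sols k).flatMap (encSolution q.varList) := by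
    obtain ⟨m, hm, v, hv⟩ := exists_procRun_eq
      (newOutput q.bqp q.varList (fun t u => q.criterion.toFun t u q.bqp) q.seeds.toList) W k
    obtain ⟨n, hn, h⟩ := hM U L W m
    exact ⟨n, hm.trans hn, by rw [h, hv, roundOutput_newOutput]⟩
  have hdom {μ : Valuation V U L} (hμ : μ ∈ q.eval W) : μ.dom = {v | v ∈ q.varList} :=
    hμ.1.trans q.mem_varList.symm
  constructor
  · intro k
    obtain ⟨n, hn, h⟩ := hout k
    -- The output after `k` steps may stop inside an encoding; it is compared with a later step at
    -- which the outputs of complete rounds are present.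
    refine IsPrefixOfEncoding.of_prefix ?_ (output_prefix_of_le M W hn)
    have he : (sols k).flatMap (encSolution q.varList) =
        ((sols k).map (valuationOf q.varList)).flatMap encValuation := by
      rw [List.flatMap_map]
      exact List.flatMap_congr fun xs hxs => (encValuation_valuationOf (hlen hxs)).symm
    rw [h, he]
    refine isPrefixOfEncoding_flatMap ?_ ?_ fun μ hμ => ?_
    · refine (Set.countable_range (valuationOf q.varList)).mono fun μ hμ => ?_
      obtain ⟨xs, -, hxs⟩ := exists_valuationOf_eq (hdom hμ)
      exact ⟨xs, hxs⟩
    · exact (nodup_flatMap_newSolutions k).map_on fun xs hx ys hy =>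
        valuationOf_injective (Finset.sort_nodup _ _) (hlen hx) (hlen hy)
    · obtain ⟨xs, hxs, rfl⟩ := List.mem_map.1 hμ
      obtain ⟨i, -, hi⟩ := List.mem_flatMap.1 hxs
      exact (q.valuationOf_mem_eval W (hlen hxs)).2 ⟨i, hi⟩
  · intro μ hμ
    obtain ⟨xs, hxs, rfl⟩ := exists_valuationOf_eq (hdom hμ)
    obtain ⟨i, hi⟩ := (q.valuationOf_mem_eval W hxs).1 hμ
    obtain ⟨n, -, h⟩ := hout (i + 1)
    refine ⟨n, ?_⟩
    have he : encValuation (valuationOf q.varList xs) = encSolution q.varList xs :=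
      encValuation_valuationOf hxs
    rw [h, he]
    have hm : xs ∈ sols (i + 1) := List.mem_flatMap.2 ⟨i, List.mem_range.2 i.lt_succ_self, hi⟩
    exact List.infix_of_mem_flatten (List.mem_map_of_mem hm)

end

end LinkedData

theorem mainTheorem2 (V U L : Type) [Denumerable V] [Denumerable U] [Denumerable L]
    (q : LinkedData.CLDQuery V U L) :
    LinkedData.FinitelyComputable q.eval ∨ LinkedData.EventuallyComputable q.eval :=
  .inr q.eventuallyComputable
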